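/- Let $d\ge 1$, $0\le N_s\le N$, $\Gamma=[-1,1]^N$, let $\rho$ be a probability density on $\Gamma$, and write $L^2_\rho(\Gamma;X)$ for the Bochner space of square integrable $X$-valued functions with respect to $\rho(\mathbf y)\,d\mathbf y$. Let $U\subset\mathbb R^d$ be a bounded open set. $H^1(U)$ carries the norm $\|v\|_{H^1(U)}=(\|v\|_{L^2(U)}^2+\|\nabla v\|_{L^2(U)}^2)^{1/2}$, $H^1_0(U)$ is the closure of $C_c^\infty(U)$ in this norm and carries the same norm, and $C_P(U)$ is the Poincaré constant, the smallest $C\geq 0$ with $\|v\|_{H^1(U)}\le C\|\nabla v\|_{L^2(U)}$ for all $v\in H^1_0(U)$. Vectors carry the Euclidean norm and matrices the spectral norm, and $L^\infty$ norms of vector fields are taken with the Euclidean norm. *Domains.* Let $\hat v\in C^1(U;\mathbb R^d)$ be bounded, let $b_1,\dots,b_N\in W^{1,\infty}(U)$ (continuous representatives) with $\|b_l\|_{L^\infty(U)}=1$, and let $\mu_1\ge\dots\ge\mu_N\ge 0$. For $\mathbf y\in\Gamma$ put $$F(x,\mathbf y)=x+\sum_{l=1}^N\sqrt{\mu_l}\,b_l(x)\,y_l\,\hat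 v(x),\qquad B_l=b_l\,\partial\hat v+\hat v\,(\nabla b_l)^T,\qquad \partial F(x,\mathbf y)=I+\sum_{l=1}^N\sqrt{\mu_l}\,y_l\,B_l(x),$$ $C=\partial F^T\partial F$, $|\partial F|=|\det \partial F|$, $D(\mathbf y)=F(U,\mathbf y)$ and $\mathcal G=\bigcup_{\mathbf y\in\Gamma}D(\mathbf y)$. Assume that for every $\mathbf y\in\Gamma$ the map $F(\cdot,\mathbf y)$ is one-to-one on $U$ and, for a.e. $x\in U$, $0<\mathbb F_{\min}\le\sigma_{\min}(\partial F(x,\mathbf y))$ and $\sigma_{\max}(\partial F(x,\mathbf y))\le\mathbb F_{\max}<\infty$. Assume also that $\sum_{l=1}^N\sqrt{\mu_l}\,\|B_l(x)\|\le 1-\tilde\delta$ for a.e. $x\in U$, with some $0<\tilde\delta<1$. *Data.* For $\mathbf y\in\Gamma$ let $a(\cdot,\mathbf y)$ be measurable on $D(\mathbf y)$ with $0<a_{\min}\le a(\cdot,\mathbf y)\le a_{\max}<\infty$ a.e. on $D(\mathbf y)$, and assume that $(a\circ F)(x)=a(F(x,\mathbf y),\mathbf y)$ does not depend on $\mathbf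 y$. Let $f:\mathbb R^d\to\mathbb R$ have an analytic extension to an open subset of $\mathbb C^d$ containing $\mathbb R^d$, and assume that $\|f(F(\cdot,\mathbf y))\|_{W^{1,\infty}(U)}$ is bounded uniformly in $\mathbf y\in\Gamma$. Let $\hat{\mathbf w}\in H^1(U)$ (a lifting of the boundary datum, independent of $\mathbf y$). *Solution.* For every $\mathbf y\in\Gamma$ let $\tilde u(\mathbf y)\in H^1_0(U)$ be the solution, pulled back to $U$, of $$\int_U (a\circ F)\,(\nabla\tilde u(\mathbf y))^TC^{-1}\nabla v\,|\partial F|\,dx=\int_U (f\circ F)\,|\partial F|\,v\,dx-\int_U(a\circ F)\,(\nabla\hat{\mathbf w})^TC^{-1}\nabla v\,|\partial F|\,dx\qquad\forall v\in H^1_0(U),$$ where $F$, $\partial F$, $C$ are taken at $\mathbf y$. Write $\mathbf y=(\mathbf y_s,\mathbf y_f)$ with $\mathbf y_s\in[-1,1]^{N_s}$, $\tilde u(\mathbf y_s,\mathbf y_f)=\tilde u(\mathbf y)$ and $\tilde u(\mathbf y_s)=\tilde u(\mathbf y_s,0)$, the solution for the parametrization truncated to its first $N_s$ variables. *Claim.*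 The functions $\mathbf y\mapsto\tilde u(\mathbf y_s,\mathbf y_f)$ and $\mathbf y\mapsto\tilde u(\mathbf y_s)$ belong to $L^2_\rho(\Gamma;H^1_0(U))$, the norm $\|f\|_{W^{1,\infty}(\mathcal G)}:=\sup_{\mathcal G}\max(|f|,|\nabla f|)$ is finite, and $$\|\tilde u(\mathbf y_s,\mathbf y_f)-\tilde u(\mathbf y_s)\|_{L^2_\rho(\Gamma;H^1_0(U))}\le\mathcal C_1B_{\mathbb T}+\mathcal C_2C_{\mathbb T},$$ where $B_{\mathbb T}=\operatorname{ess\,sup}_{x\in U}\sum_{i=N_s+1}^N\sqrt{\mu_i}\,\|B_i(x)\|$, $C_{\mathbb T}=\sum_{i=N_s+1}^N\sqrt{\mu_i}\,\|b_i\|_{L^\infty(U)}$, $$\mathcal C_1=\mathcal C\Big(C_P(U)\,\mathbb F_{\max}^{d-1}\mathbb F_{\min}^{-2}\,d\,\|f\circ F\|_{L^2_\rho(\Gamma;L^2(U))}+a_{\max}H\,\|\hat{\mathbf w}\|_{L^2_\rho(\Gamma;H^1(U))}+a_{\max}H\,\|\tilde u(\mathbf y_s,\mathbf y_f)\|_{L^2_\rho(\Gamma;H^1_0(U))}\Big),$$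 $$\mathcal C_2=\mathcal C\,\|\hat v\|_{L^\infty(U)}\,\mathbb F_{\max}^d\,C_P(U)\,\|f\|_{W^{1,\infty}(\mathcal G)}\,\|\chi_U\|_{L^2(U)},\qquad \mathcal C=\frac{C_P(U)^2}{a_{\min}\,\mathbb F_{\min}^{d}\,\mathbb F_{\max}^{-2}},$$ $$H=\mathbb F_{\max}^{d-1}\mathbb F_{\min}^{-3}\big(\mathbb F_{\max}(2+\mathbb F_{\min}^{-1}(1-\tilde\delta))+\mathbb F_{\min}^{-1}d\big).$$ -/

import Mathlib

open MeasureTheory Set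
open scoped ENNReal NNReal ContDiff InnerProductSpace

noncomputable section

namespace RandomDomain

/-- Euclidean space `ℝ^d`. -/
abbrev E (d : ℕ) := EuclideanSpace ℝ (Fin d)

/-! ### Sobolev spaces on a set `U ⊆ ℝ^d` -/

/-- Test functions: smooth functions with compact support contained in `U`. -/
structure IsTest {d : ℕ} (U : Set (E d)) (φ : E d → ℝ) : Prop where
  smooth : ContDiff ℝ ∞ φ
  compact : HasCompactSupport φ
  supp : tsupport φ ⊆ U

/-- `g` is the weak gradient of `u` in `U`: `∫_U u ∇φ = - ∫_U φ g` for all test functions `φ`. -/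
structure IsWeakGradient {d : ℕ} (U : Set (E d)) (u : E d → ℝ) (g : E d → E d) : Prop where
  locInt : LocallyIntegrableOn u U
  locInt_grad : LocallyIntegrableOn g U
  byParts : ∀ φ : E d → ℝ, IsTest U φ →
    ∫ x in U, u x • gradient φ x = - ∫ x in U, φ x • g x

/-- Pairs (function, vector field) in `L²(U) × L²(U; ℝ^d)`, normed by
`‖(u, g)‖ = (‖u‖_{L²}² + ‖g‖_{L²}²)^{1/2}`.  A function of `H¹(U)` is represented by the pair of
itself and its weak gradient, so that this norm is the `H¹(U)` norm. -/
abbrev L2Pair {d : ℕ} (U : Set (E d)) :=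
  WithLp 2 (Lp ℝ 2 (volume.restrict U) × Lp (E d) 2 (volume.restrict U))

/-- `H¹(U)`. -/
def H1 {d : ℕ} (U : Set (E d)) : Set (L2Pair U) :=
  {p | IsWeakGradient U p.fst p.snd}

/-- `H¹₀(U)`: the closure of the test functions in the `H¹` norm. -/
def H10 {d : ℕ} (U : Set (E d)) : Submodule ℝ (L2Pair U) :=
  (Submodule.span ℝ {p : L2Pair U | ∃ φ : E d → ℝ, IsTest U φ ∧
    p.fst =ᵐ[volume.restrict U] φ ∧ p.snd =ᵐ[volume.restrict U] gradient φ}).topologicalClosure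

/-- The Poincaré constant `C_P(U)`: the smallest `C ≥ 0` such that
`‖v‖_{H¹(U)} ≤ C ‖∇v‖_{L²(U)}` for all `v ∈ H¹₀(U)`. -/
def poincareConst {d : ℕ} (U : Set (E d)) : ℝ :=
  sInf {C : ℝ | 0 ≤ C ∧ ∀ v ∈ H10 U, ‖v‖ ≤ C * ‖v.snd‖}

/-- The norm `‖u‖_{L^∞(U)}`. -/
def linfNorm {d : ℕ} {X : Type*} [NormedAddCommGroup X] (U : Set (E d)) (u : E d → X) : ℝ :=
  (eLpNorm u ∞ (volume.restrict U)).toReal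

/-- The norm `max (‖u‖_{L^∞(U)}, ‖∇u‖_{L^∞(U)})` of `W^{1,∞}(U)` with the weak gradient;
it is `∞` if `u` has no weak gradient in `U`. -/
def w1infNorm {d : ℕ} (U : Set (E d)) (u : E d → ℝ) : ℝ≥0∞ :=
  ⨅ (g : E d → E d) (_ : IsWeakGradient U u g),
    max (eLpNorm u ∞ (volume.restrict U)) (eLpNorm g ∞ (volume.restrict U))

/-- The norm `sup_G max (|f|, |∇f|)`; for a function `f` of class `C¹` on the whole space and an
open set `G` this is the norm of `f` in `W^{1,∞}(G)`. -/
def c1Norm {d : ℕ} (G : Set (E d)) (f : E d → ℝ) : ℝ≥0∞ :=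
  ⨆ z ∈ G, max ‖f z‖ₑ ‖gradient f z‖ₑ

/-! ### The parametrized domains -/

/-- The parameter domain `Γ = [-1,1]^N`. -/
def Gam (N : ℕ) : Set (Fin N → ℝ) := {y | ∀ i, y i ∈ Icc (-1 : ℝ) 1}

/-- The measure `ρ(y) dy` on `Γ`. -/
def paramMeasure {N : ℕ} (ρ : (Fin N → ℝ) → ℝ) : Measure (Fin N → ℝ) :=
  (volume.restrict (Gam N)).withDensity fun y => ENNReal.ofReal (ρ y)

/-- The point `(y_s, 0)`: the coordinates with index `≥ Ns` (counted from `0`) are set to `0`. -/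
def trunc {N : ℕ} (Ns : ℕ) (y : Fin N → ℝ) : Fin N → ℝ :=
  fun i => if (i : ℕ) < Ns then y i else 0

/-- The data of the map `F(x,y) = x + (∑ₗ √μₗ bₗ(x) yₗ) v̂(x)`: the reference domain `U`, the
vector field `v̂`, the functions `bₗ` with their weak gradients, and the numbers `μₗ`. -/
structure Param (d N : ℕ) where
  U : Set (E d)
  vhat : E d → E d
  b : Fin N → E d → ℝ
  gradb : Fin N → E d → E d
  mu : Fin N → ℝ

namespace Param

variable {d N : ℕ} (P : Param d N)

/-- `F(x,y) = x + e(x,y) v̂(x)` with `e(x,y) = ∑ₗ √μₗ bₗ(x) yₗ`. -/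
def F (x : E d) (y : Fin N → ℝ) : E d :=
  x + (∑ l, Real.sqrt (P.mu l) * P.b l x * y l) • P.vhat x

/-- The domain `D(y) = F(U,y)`. -/
def D (y : Fin N → ℝ) : Set (E d) := (fun x => P.F x y) '' P.U

/-- The union `𝒢` of all domains `D(y)`, `y ∈ Γ`. -/
def G : Set (E d) := ⋃ y ∈ Gam N, P.D y

/-- `Bₗ(x) = bₗ(x) ∂v̂(x) + v̂(x) ⊗ ∇bₗ(x)`, the matrix with entries
`bₗ ∂ⱼv̂ᵢ + v̂ᵢ ∂ⱼbₗ`, as a linear map; its norm is the spectral norm. -/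
def B (l : Fin N) (x : E d) : E d →L[ℝ] E d :=
  P.b l x • fderiv ℝ P.vhat x + (innerSL ℝ (P.gradb l x)).smulRight (P.vhat x)

/-- The Jacobian `∂F(x,y) = I + ∑ₗ √μₗ yₗ Bₗ(x)`. -/
def jac (x : E d) (y : Fin N → ℝ) : E d →L[ℝ] E d :=
  ContinuousLinearMap.id ℝ (E d) + ∑ l, (Real.sqrt (P.mu l) * y l) • P.B l x

/-- `C(x,y) = ∂Fᵀ ∂F`. -/
def C (x : E d) (y : Fin N → ℝ) : E d →L[ℝ] E d :=
  (ContinuousLinearMap.adjoint (P.jac x y)).comp (P.jac x y)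

/-- The bilinear form `∫_U (a ∘ F) (∇s)ᵀ C⁻¹ ∇v |∂F|`; `a z y` is the diffusion coefficient at the
point `z ∈ D(y)` for the parameter `y`. -/
def bform (a : E d → (Fin N → ℝ) → ℝ) (y : Fin N → ℝ) (s v : L2Pair P.U) : ℝ :=
  ∫ x in P.U, a (P.F x y) y * ⟪s.snd x, (P.C x y).inverse (v.snd x)⟫_ℝ * |(P.jac x y).det|

/-- The linear form `∫_U (f ∘ F) |∂F| v - ∫_U (a ∘ F) (∇w)ᵀ C⁻¹ ∇v |∂F|`. -/
def lform (a : E d → (Fin N → ℝ) → ℝ) (f : E d → ℝ) (w : L2Pair P.U) (y : Fin N → ℝ)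
    (v : L2Pair P.U) : ℝ :=
  (∫ x in P.U, f (P.F x y) * |(P.jac x y).det| * v.fst x) - P.bform a y w v

/-- `u ∈ H¹₀(U)` is the solution, pulled back to `U`, for the parameter `y`. -/
def IsSolution (a : E d → (Fin N → ℝ) → ℝ) (f : E d → ℝ) (w : L2Pair P.U) (y : Fin N → ℝ)
    (u : H10 P.U) : Prop :=
  ∀ v : H10 P.U, P.bform a y (u : L2Pair P.U) (v : L2Pair P.U) = P.lform a f w y v

/-- Standing assumptions on the parametrization. -/
structure Regular : Prop where
  isOpen : IsOpen P.U
  bounded : Bornology.IsBounded P.U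
  vhat_C1 : ContDiffOn ℝ 1 P.vhat P.U
  vhat_bdd : ∃ K : ℝ, ∀ x ∈ P.U, ‖P.vhat x‖ ≤ K
  injective : ∀ y ∈ Gam N, InjOn (fun x => P.F x y) P.U
  /-- `bₗ ∈ W^{1,∞}(U)`, given by its continuous representative -/
  b_cont : ∀ l, ContinuousOn (P.b l) P.U
  b_memLp : ∀ l, MemLp (P.b l) ∞ (volume.restrict P.U)
  gradb_memLp : ∀ l, MemLp (P.gradb l) ∞ (volume.restrict P.U)
  b_weakGrad : ∀ l, IsWeakGradient P.U (P.b l) (P.gradb l)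
  b_norm : ∀ l, linfNorm P.U (P.b l) = 1
  mu_nonneg : ∀ l, 0 ≤ P.mu l
  mu_anti : Antitone P.mu

/-- `Fmin ≤ σ_min(∂F)` and `σ_max(∂F) ≤ Fmax` almost everywhere in `U`, for all `y ∈ Γ`. -/
structure JacobianBounds (Fmin Fmax : ℝ) : Prop where
  pos : 0 < Fmin
  lower : ∀ y ∈ Gam N, ∀ᵐ x ∂(volume.restrict P.U), ∀ h : E d, Fmin * ‖h‖ ≤ ‖P.jac x y h‖
  upper : ∀ y ∈ Gam N, ∀ᵐ x ∂(volume.restrict P.U), ‖P.jac x y‖ ≤ Fmax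

/-- The diffusion coefficient: `0 < amin ≤ a ≤ amax` on `D(y)`, and `a ∘ F` does not depend on the
parameter. -/
structure Coefficient (a : E d → (Fin N → ℝ) → ℝ) (amin amax : ℝ) : Prop where
  pos : 0 < amin
  meas : ∀ y ∈ Gam N, AEStronglyMeasurable (fun z => a z y) (volume.restrict (P.D y))
  bounds : ∀ y ∈ Gam N, ∀ᵐ z ∂(volume.restrict (P.D y)), amin ≤ a z y ∧ a z y ≤ amax
  indep : ∀ y ∈ Gam N, ∀ y' ∈ Gam N, ∀ᵐ x ∂(volume.restrict P.U),
    a (P.F x y) y = a (P.F x y') y'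

/-- `∑ₗ ‖Bₗ(x)‖ √μₗ ≤ 1 - δ` with `0 < δ < 1`. -/
structure SmallPerturbation (δ : ℝ) : Prop where
  pos : 0 < δ
  lt_one : δ < 1
  bound : ∀ᵐ x ∂(volume.restrict P.U), ∑ l, ‖P.B l x‖ * Real.sqrt (P.mu l) ≤ 1 - δ

/-- `B_𝕋 = sup_{x ∈ U} ∑_{i > Ns} √μᵢ ‖Bᵢ(x)‖` (essential supremum). -/
def BT (Ns : ℕ) : ℝ :=
  linfNorm P.U fun x =>
    ∑ i ∈ Finset.univ.filter (fun i : Fin N => Ns ≤ (i : ℕ)), Real.sqrt (P.mu i) * ‖P.B i x‖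

/-- `C_𝕋 = ∑_{i > Ns} √μᵢ ‖bᵢ‖_{L^∞(U)}`. -/
def CT (Ns : ℕ) : ℝ :=
  ∑ i ∈ Finset.univ.filter (fun i : Fin N => Ns ≤ (i : ℕ)),
    Real.sqrt (P.mu i) * linfNorm P.U (P.b i)

/-- `‖f ∘ F‖_{L²_ρ(Γ; L²(U))}`. -/
def fNorm (ρ : (Fin N → ℝ) → ℝ) (f : E d → ℝ) : ℝ :=
  (eLpNorm (fun y => (eLpNorm (fun x => f (P.F x y)) 2 (volume.restrict P.U)).toReal) 2
    (paramMeasure ρ)).toReal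

end Param

/-- The norm of `L²_ρ(Γ; X)`. -/
def bochnerNorm {N : ℕ} {X : Type*} [NormedAddCommGroup X] (ρ : (Fin N → ℝ) → ℝ)
    (v : (Fin N → ℝ) → X) : ℝ :=
  (eLpNorm v 2 (paramMeasure ρ)).toReal

/-- `H(Fmax, Fmin, δ, d)`. -/
def Hconst (Fmax Fmin δ : ℝ) (d : ℕ) : ℝ :=
  Fmax ^ (d - 1) * Fmin⁻¹ ^ 3 * (Fmax * (2 + Fmin⁻¹ * (1 - δ)) + Fmin⁻¹ * d)

/-- `𝒞 = C_P(U)² / (amin Fmin^d Fmax^{-2})`. -/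
def Cconst (CP amin Fmin Fmax : ℝ) (d : ℕ) : ℝ :=
  CP ^ 2 / (amin * Fmin ^ d * Fmax⁻¹ ^ 2)

/-- `f` extends to a holomorphic function on an open subset of `ℂ^d` containing `ℝ^d`. -/
def HasAnalyticExtension {d : ℕ} (f : E d → ℝ) : Prop :=
  ∃ (W : Set (EuclideanSpace ℂ (Fin d))) (fc : EuclideanSpace ℂ (Fin d) → ℂ),
    IsOpen W ∧ AnalyticOnNhd ℂ fc W ∧
    ∀ x : E d, WithLp.toLp 2 (fun i => (x i : ℂ)) ∈ W ∧
      fc (WithLp.toLp 2 (fun i => (x i : ℂ))) = (f x : ℂ)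

end RandomDomain

end

namespace RandomDomain

/-! ### Determinants and inverses of operators on Euclidean space -/

section LinearAlgebra

variable {d : ℕ}

/-! The argument is a perturbation estimate for a coercive variational problem. On the fixed domain
`P.U` the parameter enters only through the matrix `pullbackMatrix` $= |\det A|\,(A^TA)^{-1}$ with
$A=\partial F$, the factor $|\det A|$ and $f\circ F$; the coefficient $a\circ F$ does not change.
Let $u,u'$ solve the problems at $y,y'$ and put $e=u-u'$. Subtracting the two equations tested with
$e$ gives $b_{y'}(e,e) = [b_{y'}(u+w,e)-b_y(u+w,e)] + [\ell_y(e)-\ell_{y'}(e)]$, where $\ell$ is the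
load alone. The left side is at least $c\|\nabla e\|^2$ with $c = a_{\min}F_{\min}^dF_{\max}^{-2}$
(`Regular.coercive_bform`), and the right side is small with $\beta\ge\|\partial F(y)-\partial
F(y')\|$ and $\gamma\ge|f\circ F(y)-f\circ F(y')|$ (`Regular.abs_bform_sub_le`,
`Regular.abs_load_sub_le`). Poincaré's inequality turns this into the stability bound
`Regular.norm_solution_sub_le`.

That bound is used twice. For arbitrary $y'\to y$ it shows that $u$ is continuous on the compact set
$\Gamma$, hence bounded and in $L^2_\rho$ (`Regular.continuousOn_solution`). For $y'$ the truncation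
of $y$ one may take $\beta=B_{\mathbb T}$ and $\gamma$ a multiple of $C_{\mathbb T}$; Minkowski's
inequality in $L^2_\rho$ then integrates the pointwise bound over $y$.

The bound on $f\circ F$ needs no convexity of $\mathcal G$: since $F(x,\cdot)$ is affine and
$\Gamma$ convex, the segment from $F(x,y)$ to $F(x,y')$ stays in $\mathcal G$. The sharp constants
are smaller than those claimed; the gap is closed by $F_{\min}\le1$, which holds because $\partial
F(x,0)=I$, and by $C_P\ge1$. -/

theorem det_eq_volumeForm :
    ∃ v : MultilinearMap ℝ (fun _ : Fin d => E d) ℝ, (∀ m, ‖v m‖ ≤ 1 * ∏ i, ‖m i‖) ∧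
      ∀ A : E d →L[ℝ] E d, A.det = v (fun i => A (EuclideanSpace.basisFun (Fin d) ℝ i)) := by
  have : Fact (Module.finrank ℝ (E d) = d) := ⟨by simp⟩
  set b := EuclideanSpace.basisFun (Fin d) ℝ
  set o : Orientation ℝ (E d) (Fin d) := b.toBasis.orientation
  refine ⟨o.volumeForm.toMultilinearMap, fun m => ?_, fun A => ?_⟩
  -- Hadamard's inequality.
  · simpa using o.abs_volumeForm_apply_le m
  · have h := b.toBasis.det_comp (A : E d →ₗ[ℝ] E d) b.toBasis
    rw [Module.Basis.det_self, mul_one] at h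
    have h2 := o.volumeForm_robust b rfl
    change _ = o.volumeForm _
    rw [h2]
    convert h.symm using 2
    funext i
    simp [Function.comp]

theorem norm_apply_basisFun_le (A : E d →L[ℝ] E d) (i : Fin d) :
    ‖A (EuclideanSpace.basisFun (Fin d) ℝ i)‖ ≤ ‖A‖ := by
  have := A.le_opNorm (EuclideanSpace.basisFun (Fin d) ℝ i)
  simpa using this

theorem abs_det_le (A : E d →L[ℝ] E d) : |A.det| ≤ ‖A‖ ^ d := by
  obtain ⟨v, hv, h⟩ := det_eq_volumeForm (d := d)
  rw [h, ← Real.norm_eq_abs]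
  refine (hv _).trans ?_
  rw [one_mul]
  refine (Finset.prod_le_prod (fun _ _ => norm_nonneg _)
    fun i _ => norm_apply_basisFun_le A i).trans ?_
  simp

/-- The determinant is multilinear in the $d$ columns. Exchanging them one at a time costs, by
Hadamard, at most $K^{d-1}\|A-B\|$ each. -/
theorem abs_det_sub_le {A B : E d →L[ℝ] E d} {K : ℝ} (hA : ‖A‖ ≤ K) (hB : ‖B‖ ≤ K) :
    |A.det - B.det| ≤ d * K ^ (d - 1) * ‖A - B‖ := by
  obtain ⟨v, hv, h⟩ := det_eq_volumeForm (d := d)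
  have hK : 0 ≤ K := (norm_nonneg _).trans hA
  rw [h, h, ← Real.norm_eq_abs]
  refine (v.norm_image_sub_le_of_bound zero_le_one hv _ _).trans ?_
  rw [one_mul, Fintype.card_fin]
  gcongr
  · exact max_le
      ((pi_norm_le_iff_of_nonneg hK).2 fun i => (norm_apply_basisFun_le A i).trans hA)
      ((pi_norm_le_iff_of_nonneg hK).2 fun i => (norm_apply_basisFun_le B i).trans hB)
  · refine (pi_norm_le_iff_of_nonneg (norm_nonneg _)).2 fun i => ?_
    simpa using norm_apply_basisFun_le (A - B) i

theorem exists_inverse_of_le {A : E d →L[ℝ] E d} {m : ℝ} (hm : 0 < m)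
    (h : ∀ x, m * ‖x‖ ≤ ‖A x‖) :
    ∃ S : E d →L[ℝ] E d, A * S = 1 ∧ S * A = 1 ∧ ‖S‖ ≤ m⁻¹ := by
  have hinj : Function.Injective (A : E d →ₗ[ℝ] E d) := by
    rw [injective_iff_map_eq_zero]
    intro x hx
    have hx' : A x = 0 := hx
    have := h x
    rw [hx', norm_zero] at this
    exact norm_le_zero_iff.1 (by nlinarith [norm_nonneg x])
  set e := (LinearEquiv.ofInjectiveEndo (A : E d →ₗ[ℝ] E d) hinj).toContinuousLinearEquiv
  have he : ∀ x, e x = A x := fun x => rfl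
  have h1 : ∀ x, A (e.symm x) = x := fun x => by rw [← he]; simp
  refine ⟨(e.symm : E d →L[ℝ] E d), ?_, ?_, ?_⟩
  · ext1 x; exact h1 x
  · ext1 x
    change e.symm (A x) = x
    rw [← he]; simp
  · refine ContinuousLinearMap.opNorm_le_bound _ (inv_nonneg.2 hm.le) fun x => ?_
    have := h (e.symm x)
    rw [h1] at this
    change ‖e.symm x‖ ≤ _
    rw [inv_mul_eq_div, le_div_iff₀ hm]
    linarith

/-- This is the upper bound `abs_det_le` applied to $A^{-1}$, whose norm is at most $m^{-1}$. -/
theorem pow_le_abs_det {A : E d →L[ℝ] E d} {m : ℝ} (hm : 0 < m)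
    (h : ∀ x, m * ‖x‖ ≤ ‖A x‖) : m ^ d ≤ |A.det| := by
  obtain ⟨S, hS, -, hn⟩ := exists_inverse_of_le hm h
  have h1 : A.det * S.det = 1 := by
    have : LinearMap.det ((A * S : E d →L[ℝ] E d) : E d →ₗ[ℝ] E d) = 1 := by
      rw [hS]; exact LinearMap.det_id
    rw [← this]
    exact (LinearMap.det_comp (A : E d →ₗ[ℝ] E d) S).symm
  have h2 : |S.det| ≤ m⁻¹ ^ d := (abs_det_le S).trans (by gcongr)
  have h3 : |A.det| * |S.det| = 1 := by rw [← abs_mul, h1, abs_one]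
  have h4 : 1 ≤ |A.det| * m⁻¹ ^ d := by rw [← h3]; gcongr
  rwa [inv_pow, ← div_eq_mul_inv, le_div_iff₀ (by positivity), one_mul] at h4

/-- The inverse of `AᵀA`. -/
theorem inverse_adjoint_comp_self {A S : E d →L[ℝ] E d} (h1 : A * S = 1) (h2 : S * A = 1) :
    ((ContinuousLinearMap.adjoint A).comp A).inverse
      = S * ContinuousLinearMap.adjoint S := by
  have h3 : ContinuousLinearMap.adjoint S * ContinuousLinearMap.adjoint A = 1 := by
    have := congrArg ContinuousLinearMap.adjoint h1
    rw [ContinuousLinearMap.mul_def, ContinuousLinearMap.adjoint_comp] at this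
    rw [ContinuousLinearMap.mul_def, this]
    exact ContinuousLinearMap.adjoint_id
  have h4 : ContinuousLinearMap.adjoint A * ContinuousLinearMap.adjoint S = 1 := by
    have := congrArg ContinuousLinearMap.adjoint h2
    rw [ContinuousLinearMap.mul_def, ContinuousLinearMap.adjoint_comp] at this
    rw [ContinuousLinearMap.mul_def, this]
    exact ContinuousLinearMap.adjoint_id
  refine ContinuousLinearMap.inverse_eq ?_ ?_
  · change (ContinuousLinearMap.adjoint A * A) * (S * ContinuousLinearMap.adjoint S) = 1
    rw [mul_assoc, ← mul_assoc A, h1, one_mul, h4]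
  · change (S * ContinuousLinearMap.adjoint S) * (ContinuousLinearMap.adjoint A * A) = 1
    rw [mul_assoc, ← mul_assoc _ _ A, h3, one_mul, h2]

/-- The matrix `(AᵀA)⁻¹ |det A|` of the pulled back form. -/
noncomputable def pullbackMatrix (A : E d →L[ℝ] E d) : E d →L[ℝ] E d :=
  |A.det| • ((ContinuousLinearMap.adjoint A).comp A).inverse

theorem pullbackMatrix_eq {A S : E d →L[ℝ] E d} (h1 : A * S = 1) (h2 : S * A = 1) :
    pullbackMatrix A = |A.det| • (S * ContinuousLinearMap.adjoint S) := by
  rw [pullbackMatrix, inverse_adjoint_comp_self h1 h2]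

/-- With $S=A^{-1}$ the quadratic form is $|\det A|\,\|S^Tx\|^2$, and $x=A^TS^Tx$ forces $\|x\|\le
M\|S^Tx\|$. -/
theorem pullbackMatrix_coercive {A : E d →L[ℝ] E d} {m M : ℝ} (hm : 0 < m) (hM : 0 < M)
    (h : ∀ x, m * ‖x‖ ≤ ‖A x‖) (hA : ‖A‖ ≤ M) (x : E d) :
    m ^ d * M⁻¹ ^ 2 * ‖x‖ ^ 2 ≤ ⟪x, pullbackMatrix A x⟫_ℝ := by
  obtain ⟨S, h1, h2, -⟩ := exists_inverse_of_le hm h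
  rw [pullbackMatrix_eq h1 h2, smul_apply, inner_smul_right,
    mul_apply_eq_comp, ← ContinuousLinearMap.adjoint_inner_left,
    real_inner_self_eq_norm_sq, mul_assoc]
  have h4 : ContinuousLinearMap.adjoint A * ContinuousLinearMap.adjoint S = 1 := by
    have := congrArg ContinuousLinearMap.adjoint h2
    rw [ContinuousLinearMap.mul_def, ContinuousLinearMap.adjoint_comp] at this
    rw [ContinuousLinearMap.mul_def, this]
    exact ContinuousLinearMap.adjoint_id
  have h5 : ContinuousLinearMap.adjoint A (ContinuousLinearMap.adjoint S x) = x :=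
    congrArg (fun T : E d →L[ℝ] E d => T x) h4
  have h6 : ‖x‖ ≤ M * ‖ContinuousLinearMap.adjoint S x‖ := by
    conv_lhs => rw [← h5]
    refine (ContinuousLinearMap.le_opNorm _ _).trans ?_
    rw [LinearIsometryEquiv.norm_map]
    gcongr
  have h7 : M⁻¹ * ‖x‖ ≤ ‖ContinuousLinearMap.adjoint S x‖ := by
    rwa [inv_mul_le_iff₀ hM]
  rw [← mul_pow]
  gcongr
  exact pow_le_abs_det hm h

theorem norm_pullbackMatrix_le {A : E d →L[ℝ] E d} {m M : ℝ} (hm : 0 < m)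
    (h : ∀ x, m * ‖x‖ ≤ ‖A x‖) (hA : ‖A‖ ≤ M) :
    ‖pullbackMatrix A‖ ≤ M ^ d * m⁻¹ ^ 2 := by
  obtain ⟨S, h1, h2, hn⟩ := exists_inverse_of_le hm h
  rw [pullbackMatrix_eq h1 h2, norm_smul, Real.norm_eq_abs, abs_abs]
  have : ‖S * ContinuousLinearMap.adjoint S‖ ≤ m⁻¹ ^ 2 := by
    refine (norm_mul_le _ _).trans ?_
    rw [LinearIsometryEquiv.norm_map, ← pow_two]
    gcongr
  have h4 : |A.det| ≤ M ^ d := (abs_det_le A).trans (by gcongr)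
  exact mul_le_mul h4 this (norm_nonneg _) ((abs_nonneg _).trans h4)

theorem norm_pullbackMatrix_sub_le {A B : E d →L[ℝ] E d} {m M : ℝ} (hm : 0 < m)
    (hA : ∀ x, m * ‖x‖ ≤ ‖A x‖) (hB : ∀ x, m * ‖x‖ ≤ ‖B x‖) (hAM : ‖A‖ ≤ M) (hBM : ‖B‖ ≤ M) :
    ‖pullbackMatrix A - pullbackMatrix B‖ ≤
      (2 * M ^ d * m⁻¹ ^ 3 + d * M ^ (d - 1) * m⁻¹ ^ 2) * ‖A - B‖ := by
  obtain ⟨S, h1, h2, hn⟩ := exists_inverse_of_le hm hA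
  obtain ⟨T, h3, h4, hn'⟩ := exists_inverse_of_le hm hB
  have hM : 0 ≤ M := (norm_nonneg _).trans hAM
  have hST : ‖S - T‖ ≤ m⁻¹ ^ 2 * ‖A - B‖ := by
    -- The resolvent identity $A^{-1}-B^{-1}=A^{-1}(B-A)B^{-1}$.
    have : S - T = S * (B - A) * T := by
      rw [mul_sub, sub_mul, h2, one_mul, mul_assoc, h3, mul_one]
    rw [this]
    refine (norm_mul_le _ _).trans ?_
    refine (mul_le_mul_of_nonneg_right (norm_mul_le _ _) (norm_nonneg _)).trans ?_
    rw [norm_sub_rev B A]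
    calc ‖S‖ * ‖A - B‖ * ‖T‖ ≤ m⁻¹ * ‖A - B‖ * m⁻¹ := by gcongr
      _ = _ := by ring
  have hST' : ‖ContinuousLinearMap.adjoint S - ContinuousLinearMap.adjoint T‖
      ≤ m⁻¹ ^ 2 * ‖A - B‖ := by
    rwa [← map_sub, LinearIsometryEquiv.norm_map]
  have hS' : ‖ContinuousLinearMap.adjoint S‖ ≤ m⁻¹ := by rwa [LinearIsometryEquiv.norm_map]
  have hT' : ‖ContinuousLinearMap.adjoint T‖ ≤ m⁻¹ := by rwa [LinearIsometryEquiv.norm_map]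
  -- Telescoping over the three factors: the two inverses give the term with $2m^{-3}$, the
  -- determinant the term with $d$.
  have hdec : pullbackMatrix A - pullbackMatrix B =
      |A.det| • ((S - T) * ContinuousLinearMap.adjoint S
        + T * (ContinuousLinearMap.adjoint S - ContinuousLinearMap.adjoint T))
      + (|A.det| - |B.det|) • (T * ContinuousLinearMap.adjoint T) := by
    rw [pullbackMatrix_eq h1 h2, pullbackMatrix_eq h3 h4, sub_mul, mul_sub]
    module
  have e1 : ‖(S - T) * ContinuousLinearMap.adjoint S
        + T * (ContinuousLinearMap.adjoint S - ContinuousLinearMap.adjoint T)‖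
      ≤ 2 * m⁻¹ ^ 3 * ‖A - B‖ := by
    calc _ ≤ ‖S - T‖ * ‖ContinuousLinearMap.adjoint S‖
          + ‖T‖ * ‖ContinuousLinearMap.adjoint S - ContinuousLinearMap.adjoint T‖ :=
            (norm_add_le _ _).trans (add_le_add (norm_mul_le _ _) (norm_mul_le _ _))
      _ ≤ (m⁻¹ ^ 2 * ‖A - B‖) * m⁻¹ + m⁻¹ * (m⁻¹ ^ 2 * ‖A - B‖) := by gcongr
      _ = _ := by ring
  have e2 : ‖T * ContinuousLinearMap.adjoint T‖ ≤ m⁻¹ ^ 2 := by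
    refine (norm_mul_le _ _).trans ?_
    rw [pow_two]
    gcongr
  have e3 : |(|A.det| - |B.det|)| ≤ d * M ^ (d - 1) * ‖A - B‖ :=
    (abs_abs_sub_abs_le_abs_sub _ _).trans (abs_det_sub_le hAM hBM)
  have e4 : |A.det| ≤ M ^ d := (abs_det_le A).trans (by gcongr)
  rw [hdec]
  refine (norm_add_le _ _).trans ?_
  rw [norm_smul, norm_smul, Real.norm_eq_abs, Real.norm_eq_abs, abs_abs]
  calc _ ≤ M ^ d * (2 * m⁻¹ ^ 3 * ‖A - B‖) + (d * M ^ (d - 1) * ‖A - B‖) * m⁻¹ ^ 2 := by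
        gcongr
    _ = _ := by ring

/-- Inversion is continuous on the open set of units and takes the default value $0$ off it. -/
theorem measurable_continuousLinearMap_inverse :
    Measurable (ContinuousLinearMap.inverse : (E d →L[ℝ] E d) → (E d →L[ℝ] E d)) := by
  classical
  rw [← ContinuousLinearMap.ringInverse_eq_inverse]
  have hU : IsOpen {A : E d →L[ℝ] E d | IsUnit A} := Units.isOpen
  have hc : ContinuousOn (Ring.inverse : (E d →L[ℝ] E d) → _) {A | IsUnit A} := by
    rintro _ ⟨x, rfl⟩
    exact (NormedRing.inverse_continuousAt x).continuousWithinAt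
  have h := hc.measurable_piecewise (continuousOn_const (c := (0 : E d →L[ℝ] E d)))
    hU.measurableSet
  convert h using 1
  funext A
  by_cases hA : IsUnit A
  · exact (Set.piecewise_eq_of_mem {A | IsUnit A} _ _ hA).symm
  · exact (Ring.inverse_non_unit _ hA).trans
      (Set.piecewise_eq_of_notMem {A | IsUnit A} Ring.inverse
        (fun _ => (0 : E d →L[ℝ] E d)) hA).symm

theorem measurable_pullbackMatrix :
    Measurable (pullbackMatrix : (E d →L[ℝ] E d) → (E d →L[ℝ] E d)) := by
  have h1 : Continuous fun A : E d →L[ℝ] E d => |A.det| :=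
    ContinuousLinearMap.continuous_det.abs
  have h2 : Continuous fun A : E d →L[ℝ] E d => (ContinuousLinearMap.adjoint A).comp A :=
    (LinearIsometryEquiv.continuous _).clm_comp continuous_id
  exact h1.measurable.smul (measurable_continuousLinearMap_inverse.comp h2.measurable)

end LinearAlgebra

end RandomDomain

namespace RandomDomain

/-! ### The Cauchy-Schwarz inequality -/

section CauchySchwarz

variable {α X Y : Type*} [MeasurableSpace α] {μ : Measure α}
  [NormedAddCommGroup X] [NormedAddCommGroup Y] {s : α → X} {v : α → Y}

theorem integrable_of_abs_le_mul {g : α → ℝ} {K : ℝ} (hs : MemLp s 2 μ) (hv : MemLp v 2 μ)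
    (hgm : AEStronglyMeasurable g μ) (hg : ∀ᵐ x ∂μ, |g x| ≤ K * (‖s x‖ * ‖v x‖)) :
    Integrable g μ :=
  ((hs.norm.integrable_mul hv.norm).const_mul K).mono' hgm hg

theorem integral_norm_mul_norm_le (hs : MemLp s 2 μ) (hv : MemLp v 2 μ) :
    ∫ x, ‖s x‖ * ‖v x‖ ∂μ ≤ (eLpNorm s 2 μ).toReal * (eLpNorm v 2 μ).toReal := by
  have h := real_inner_le_norm (hs.norm.toLp _) (hv.norm.toLp _)
  rw [Lp.norm_toLp, Lp.norm_toLp, eLpNorm_norm, eLpNorm_norm, L2.inner_def] at h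
  refine le_trans (le_of_eq (integral_congr_ae ?_)) h
  filter_upwards [hs.norm.coeFn_toLp, hv.norm.coeFn_toLp] with x h1 h2
  rw [h1, h2, real_inner_eq_re_inner]
  simp [mul_comm]

theorem abs_integral_le_mul {g : α → ℝ} {K : ℝ} (hK : 0 ≤ K) (hs : MemLp s 2 μ)
    (hv : MemLp v 2 μ) (hg : ∀ᵐ x ∂μ, |g x| ≤ K * (‖s x‖ * ‖v x‖)) :
    |∫ x, g x ∂μ| ≤ K * ((eLpNorm s 2 μ).toReal * (eLpNorm v 2 μ).toReal) := by
  have h1 : |∫ x, g x ∂μ| ≤ ∫ x, K * (‖s x‖ * ‖v x‖) ∂μ :=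
    norm_integral_le_of_norm_le (f := g) (g := fun x => K * (‖s x‖ * ‖v x‖)) ((hs.norm.integrable_mul hv.norm).const_mul K) hg
  rw [integral_const_mul] at h1
  exact h1.trans (by gcongr; exact integral_norm_mul_norm_le hs hv)

end CauchySchwarz

/-! ### The Poincaré inequality in `H¹₀(U)` -/

section Poincare

variable {d : ℕ} {U : Set (E d)}

theorem IsTest.differentiable {φ : E d → ℝ} (h : IsTest U φ) : Differentiable ℝ φ :=
  h.smooth.differentiable (by simp)

theorem IsTest.continuous_fderiv {φ : E d → ℝ} (h : IsTest U φ) : Continuous (fderiv ℝ φ) :=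
  h.smooth.continuous_fderiv (by simp)

theorem IsTest.add {φ ψ : E d → ℝ} (h : IsTest U φ) (h' : IsTest U ψ) : IsTest U (φ + ψ) :=
  ⟨h.smooth.add h'.smooth, h.compact.add h'.compact,
    (tsupport_add φ ψ).trans (union_subset h.supp h'.supp)⟩

theorem IsTest.const_smul {φ : E d → ℝ} (h : IsTest U φ) (c : ℝ) : IsTest U (c • φ) :=
  ⟨contDiff_const.smul h.smooth, h.compact.smul_left (f := fun _ => c),
    (tsupport_smul_subset_right (fun _ => c) φ).trans h.supp⟩

theorem IsTest.zero : IsTest U (0 : E d → ℝ) :=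
  ⟨contDiff_const, HasCompactSupport.zero, by simp [tsupport]⟩

/-- Every element of the span of the test functions is a test function. -/
theorem exists_isTest_of_mem_span {p : L2Pair U}
    (hp : p ∈ Submodule.span ℝ {p : L2Pair U | ∃ φ : E d → ℝ, IsTest U φ ∧
      p.fst =ᵐ[volume.restrict U] φ ∧ p.snd =ᵐ[volume.restrict U] gradient φ}) :
    ∃ φ : E d → ℝ, IsTest U φ ∧
      p.fst =ᵐ[volume.restrict U] φ ∧ p.snd =ᵐ[volume.restrict U] gradient φ := by
  induction hp using Submodule.span_induction with
  | mem x hx => exact hx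
  | zero =>
    refine ⟨0, IsTest.zero, Lp.coeFn_zero _ _ _, (Lp.coeFn_zero _ _ _).trans (ae_of_all _ ?_)⟩
    intro x
    simp [gradient]
  | add x y _ _ hx hy =>
    obtain ⟨φ, h1, h2, h3⟩ := hx
    obtain ⟨ψ, k1, k2, k3⟩ := hy
    refine ⟨φ + ψ, h1.add k1, (Lp.coeFn_add _ _).trans (h2.add k2),
      (Lp.coeFn_add _ _).trans ((h3.add k3).trans (ae_of_all _ fun z => ?_))⟩
    simp [gradient, fderiv_add (h1.differentiable z) (k1.differentiable z)]
  | smul c x _ hx =>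
    obtain ⟨φ, h1, h2, h3⟩ := hx
    refine ⟨c • φ, h1.const_smul c, (Lp.coeFn_smul _ _).trans (h2.const_smul c),
      (Lp.coeFn_smul _ _).trans ((h3.const_smul c).trans (ae_of_all _ fun z => ?_))⟩
    simp [gradient, fderiv_const_smul (h1.differentiable z)]

theorem norm_sq_eq_integral {α X : Type*} [MeasurableSpace α] {μ : Measure α}
    [NormedAddCommGroup X] [InnerProductSpace ℝ X] (s : Lp X 2 μ) :
    ‖s‖ ^ 2 = ∫ x, ‖s x‖ ^ 2 ∂μ := by
  rw [← real_inner_self_eq_norm_sq, L2.inner_def]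
  simp

/-- Since $\partial_0x_0=1$, this is integration by parts of $\int(\partial_0x_0)\,\varphi^2$. It
needs one coordinate direction, hence $d>0$. -/
theorem IsTest.integral_sq (hd : 0 < d) {φ : E d → ℝ} (h : IsTest U φ) :
    ∫ x in U, φ x ^ 2
      = -∫ x in U, 2 * (x ⟨0, hd⟩ * (φ x * fderiv ℝ φ x (EuclideanSpace.single ⟨0, hd⟩ 1))) := by
  set i : Fin d := ⟨0, hd⟩
  set e : E d := EuclideanSpace.single i 1
  have hc := h.smooth.continuous
  have hdc := h.continuous_fderiv
  have hx : Continuous fun x : E d => x i := by fun_prop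
  have hder : ∀ x, fderiv ℝ (fun x : E d => x i) x e = 1 := fun x => by
    have : (fun x : E d => x i) = (EuclideanSpace.proj i : E d →L[ℝ] ℝ) := rfl
    rw [this, ContinuousLinearMap.fderiv]
    simp [e]
  have hder2 : ∀ x, fderiv ℝ (fun x => φ x ^ 2) x e = 2 * (φ x * fderiv ℝ φ x e) := fun x => by
    rw [fderiv_fun_pow _ (h.differentiable x)]
    simp
    ring
  have hz : ∀ x, x ∉ U → φ x = 0 := fun x hx => image_eq_zero_of_notMem_tsupport
    fun hx' => hx (h.supp hx')
  have hsq : HasCompactSupport fun x => φ x ^ 2 := by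
    have h1 : HasCompactSupport (φ * φ) := h.compact.mul_left
    have h2 : (fun x => φ x ^ 2) = φ * φ := by funext x; simp [pow_two]
    rwa [h2]
  have key := integral_mul_fderiv_eq_neg_fderiv_mul_of_integrable (μ := (volume : Measure (E d)))
    (f := fun x : E d => x i) (g := fun x => φ x ^ 2) (v := e) ?_ ?_ ?_ ?_ ?_
  · rw [setIntegral_eq_integral_of_forall_compl_eq_zero fun x hx => by simp [hz x hx],
      setIntegral_eq_integral_of_forall_compl_eq_zero fun x hx => by simp [hz x hx]]
    simp only [hder, hder2, one_mul] at key
    rw [← neg_eq_iff_eq_neg, ← key]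
    exact integral_congr_ae (ae_of_all _ fun x => by ring)
  · simp only [hder, one_mul]
    exact (hc.pow 2).integrable_of_hasCompactSupport hsq
  · simp only [hder2]
    refine Continuous.integrable_of_hasCompactSupport (by fun_prop) ?_
    have : HasCompactSupport fun x => φ x * (2 * (x i * fderiv ℝ φ x e)) :=
      h.compact.mul_right
    have h2 : (fun x => x i * (2 * (φ x * fderiv ℝ φ x e)))
        = fun x => φ x * (2 * (x i * fderiv ℝ φ x e)) := by funext x; ring
    rwa [h2]
  · exact (hx.mul (hc.pow 2)).integrable_of_hasCompactSupport hsq.mul_left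
  · intro x _
    fun_prop
  · intro x _
    exact (h.differentiable x).pow 2

/-- If $|x_0|\le R$ on $U$, then `IsTest.integral_sq` and Cauchy-Schwarz give
$\|\varphi\|^2\le2R\|\varphi\|\|\nabla\varphi\|$. The resulting inequality is a closed condition, so
it passes from test functions to $H^1_0$. -/
theorem exists_norm_fst_le (hd : 0 < d) (hU : IsOpen U) (hb : Bornology.IsBounded U) :
    ∃ K : ℝ, 0 ≤ K ∧ ∀ v ∈ H10 U, ‖v.fst‖ ≤ K * ‖v.snd‖ := by
  obtain ⟨R, hR0, hR⟩ : ∃ R : ℝ, 0 < R ∧ ∀ x ∈ U, ‖x‖ ≤ R := hb.exists_pos_norm_le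
  refine ⟨2 * R, by positivity, fun v hv => ?_⟩
  have hcl : IsClosed {p : L2Pair U | ‖p.fst‖ ≤ 2 * R * ‖p.snd‖} :=
    isClosed_le (WithLp.continuous_fst _ _ _).norm (continuous_const.mul
      (WithLp.continuous_snd _ _ _).norm)
  refine closure_minimal ?_ hcl hv
  intro p hp
  obtain ⟨φ, h, h1, h2⟩ := exists_isTest_of_mem_span hp
  have e1 : ‖p.fst‖ ^ 2 = ∫ x in U, φ x ^ 2 := by
    rw [norm_sq_eq_integral]
    refine integral_congr_ae ?_
    filter_upwards [h1] with x hx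
    rw [hx]; simp
  have e2 : ‖p.fst‖ ^ 2 ≤ 2 * R * (‖p.fst‖ * ‖p.snd‖) := by
    rw [e1, h.integral_sq hd]
    refine (neg_le_abs _).trans ?_
    rw [Lp.norm_def, Lp.norm_def]
    refine abs_integral_le_mul (by positivity) (Lp.memLp _) (Lp.memLp _) ?_
    filter_upwards [h1, h2, ae_restrict_mem hU.measurableSet] with x k1 k2 k3
    rw [k1, k2, abs_mul, abs_mul, abs_mul]
    have a1 : |x ⟨0, hd⟩| ≤ R := (PiLp.norm_apply_le x _).trans (hR x k3)
    have a2 : |fderiv ℝ φ x (EuclideanSpace.single ⟨0, hd⟩ 1)| ≤ ‖gradient φ x‖ := by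
      have := (fderiv ℝ φ x).le_opNorm (EuclideanSpace.single ⟨0, hd⟩ 1)
      simpa [gradient] using this
    rw [abs_of_pos (zero_lt_two' ℝ), Real.norm_eq_abs, mul_assoc]
    gcongr
  rcases (norm_nonneg p.fst).eq_or_lt with h0 | h0
  · change ‖p.fst‖ ≤ _
    rw [← h0]; positivity
  · change ‖p.fst‖ ≤ _
    nlinarith

theorem poincareConst_nonneg : 0 ≤ poincareConst U :=
  Real.sInf_nonneg fun _ h => h.1

/-- The infimum defining the constant is attained, provided some constant is admissible. -/
theorem norm_le_poincareConst (hd : 0 < d) (hU : IsOpen U) (hb : Bornology.IsBounded U)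
    {v : L2Pair U} (hv : v ∈ H10 U) : ‖v‖ ≤ poincareConst U * ‖v.snd‖ := by
  obtain ⟨K, hK, h⟩ := exists_norm_fst_le hd hU hb
  have hne : {C : ℝ | 0 ≤ C ∧ ∀ v ∈ H10 U, ‖v‖ ≤ C * ‖v.snd‖}.Nonempty := by
    -- Because $K^2+1\le(K+1)^2$.
    refine ⟨K + 1, by positivity, fun v hv => ?_⟩
    rw [WithLp.prod_norm_eq_of_L2]
    refine Real.sqrt_le_iff.2 ⟨by positivity, ?_⟩
    have := h v hv
    have h2 : ‖v.fst‖ ^ 2 ≤ (K * ‖v.snd‖) ^ 2 := by gcongr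
    nlinarith [mul_nonneg hK (sq_nonneg ‖v.snd‖)]
  rcases (norm_nonneg v.snd).eq_or_lt with h0 | h0
  · obtain ⟨C, -, hC⟩ := hne
    have := hC v hv
    rw [← h0, mul_zero] at this ⊢
    exact this
  · rw [← div_le_iff₀ h0]
    exact le_csInf hne fun C hC => (div_le_iff₀ h0).2 (hC.2 v hv)

theorem norm_snd_le (v : L2Pair U) : ‖v.snd‖ ≤ ‖v‖ := by
  rw [WithLp.prod_norm_eq_of_L2]
  exact Real.le_sqrt_of_sq_le (by nlinarith [sq_nonneg ‖v.fst‖])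

theorem norm_fst_le (v : L2Pair U) : ‖v.fst‖ ≤ ‖v‖ := by
  rw [WithLp.prod_norm_eq_of_L2]
  exact Real.le_sqrt_of_sq_le (by nlinarith [sq_nonneg ‖v.snd‖])

/-- The full norm dominates the gradient norm. A nonzero element is needed: if $H^1_0=\{0\}$ the
constant is $0$. -/
theorem one_le_poincareConst (hd : 0 < d) (hU : IsOpen U) (hb : Bornology.IsBounded U)
    {v : L2Pair U} (hv : v ∈ H10 U) (h0 : v ≠ 0) : 1 ≤ poincareConst U := by
  have h := norm_le_poincareConst hd hU hb hv
  have h1 := norm_snd_le v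
  have h2 : 0 < ‖v‖ := norm_pos_iff.2 h0
  by_contra! hlt
  rcases (norm_nonneg v.snd).eq_or_lt with h3 | h3
  · rw [← h3, mul_zero] at h; linarith
  · nlinarith

end Poincare

/-! ### Smooth functions on `ℝ^d` -/

section Smooth

variable {d : ℕ} {f : E d → ℝ}

/-- $f$ is the real part of the extension, restricted to the real-linear copy of $\mathbb R^d$ in
$\mathbb C^d$. -/
theorem HasAnalyticExtension.contDiff (hf : HasAnalyticExtension f) : ContDiff ℝ 1 f := by
  obtain ⟨W, fc, -, hfc, h⟩ := hf
  have hι : ContDiff ℝ 1 fun x : E d =>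
      (WithLp.toLp 2 (fun i => (x i : ℂ)) : EuclideanSpace ℂ (Fin d)) := by
    rw [contDiff_piLp]
    intro i
    have h1 : ContDiff ℝ 1 fun x : E d => x i := by fun_prop
    exact Complex.ofRealCLM.contDiff.comp h1
  have hfe : f = fun x => Complex.reCLM (fc (WithLp.toLp 2 (fun i => (x i : ℂ)))) := by
    funext x
    rw [(h x).2]
    simp
  rw [hfe]
  refine Complex.reCLM.contDiff.comp (contDiff_iff_contDiffAt.2 fun x => ?_)
  have h2 : AnalyticAt ℝ fc (WithLp.toLp 2 (fun i => (x i : ℂ))) :=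
    (hfc _ (h x).1).restrictScalars
  exact ContDiffAt.comp x h2.contDiffAt hι.contDiffAt

theorem norm_gradient (x : E d) : ‖gradient f x‖ = ‖fderiv ℝ f x‖ := by
  simp [gradient]

theorem c1Norm_lt_top (hf : ContDiff ℝ 1 f) {G : Set (E d)} (hG : Bornology.IsBounded G) :
    c1Norm G f < ⊤ := by
  have hK : IsCompact (closure G) := hG.isCompact_closure
  obtain ⟨K₁, h₁⟩ := hK.exists_bound_of_continuousOn hf.continuous.continuousOn
  obtain ⟨K₂, h₂⟩ := hK.exists_bound_of_continuousOn
    (hf.continuous_fderiv (by simp)).continuousOn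
  refine lt_of_le_of_lt (b := ENNReal.ofReal (max K₁ K₂)) (iSup₂_le fun z hz => ?_)
    ENNReal.ofReal_lt_top
  refine max_le ?_ ?_
  · rw [← ofReal_norm]
    exact ENNReal.ofReal_le_ofReal ((h₁ z (subset_closure hz)).trans (le_max_left _ _))
  · rw [← ofReal_norm, norm_gradient]
    exact ENNReal.ofReal_le_ofReal ((h₂ z (subset_closure hz)).trans (le_max_right _ _))

theorem norm_le_c1Norm {G : Set (E d)} (hG : c1Norm G f < ⊤) {z : E d} (hz : z ∈ G) :
    ‖f z‖ ≤ (c1Norm G f).toReal := by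
  have : ‖f z‖ₑ ≤ c1Norm G f :=
    (le_max_left _ _).trans (le_iSup₂ (f := fun z (_ : z ∈ G) => max ‖f z‖ₑ ‖gradient f z‖ₑ) z hz)
  simpa using ENNReal.toReal_mono hG.ne this

theorem norm_fderiv_le_c1Norm {G : Set (E d)} (hG : c1Norm G f < ⊤) {z : E d} (hz : z ∈ G) :
    ‖fderiv ℝ f z‖ ≤ (c1Norm G f).toReal := by
  have : ‖gradient f z‖ₑ ≤ c1Norm G f :=
    (le_max_right _ _).trans (le_iSup₂ (f := fun z (_ : z ∈ G) => max ‖f z‖ₑ ‖gradient f z‖ₑ) z hz)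
  rw [← norm_gradient]
  simpa using ENNReal.toReal_mono hG.ne this

theorem norm_sub_le_of_segment_subset (hf : ContDiff ℝ 1 f) {G : Set (E d)}
    (hG : c1Norm G f < ⊤) {z z' : E d} (h : segment ℝ z z' ⊆ G) :
    ‖f z' - f z‖ ≤ (c1Norm G f).toReal * ‖z' - z‖ :=
  (convex_segment z z').norm_image_sub_le_of_norm_fderiv_le
    (fun x _ => (hf.differentiable (by simp)) x)
    (fun _ hx => norm_fderiv_le_c1Norm hG (h hx))
    (left_mem_segment ℝ z z') (right_mem_segment ℝ z z')

end Smooth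

end RandomDomain

namespace RandomDomain

/-! ### The parameter domain -/

section Gam

variable {N : ℕ}

theorem Gam_eq_pi : Gam N = Set.pi univ fun _ => Icc (-1 : ℝ) 1 := by
  ext y; simp only [Gam, mem_ofPred_eq, mem_univ_pi]

theorem isCompact_Gam : IsCompact (Gam N) := by
  rw [Gam_eq_pi]; exact isCompact_univ_pi fun _ => isCompact_Icc

theorem convex_Gam : Convex ℝ (Gam N) := by
  rw [Gam_eq_pi]; exact convex_pi fun _ _ => convex_Icc _ _

theorem measurableSet_Gam : MeasurableSet (Gam N) := isCompact_Gam.measurableSet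

theorem zero_mem_Gam : (0 : Fin N → ℝ) ∈ Gam N := fun i => by simp

theorem abs_le_one_of_mem_Gam {y : Fin N → ℝ} (hy : y ∈ Gam N) (i : Fin N) : |y i| ≤ 1 :=
  abs_le.2 (hy i)

theorem trunc_mem_Gam (Ns : ℕ) {y : Fin N → ℝ} (hy : y ∈ Gam N) : trunc Ns y ∈ Gam N := by
  intro i
  unfold trunc
  split_ifs
  · exact hy i
  · simp

theorem continuous_trunc (Ns : ℕ) : Continuous (trunc Ns : (Fin N → ℝ) → _) := by
  refine continuous_pi fun i => ?_
  unfold trunc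
  split_ifs <;> fun_prop

end Gam

theorem ae_norm_le_linfNorm {d : ℕ} {X : Type*} [NormedAddCommGroup X] {U : Set (E d)}
    {g : E d → X} (hg : eLpNorm g ∞ (volume.restrict U) ≠ ⊤) :
    ∀ᵐ x ∂(volume.restrict U), ‖g x‖ ≤ linfNorm U g := by
  filter_upwards [ae_le_eLpNormEssSup (f := g) (μ := volume.restrict U)] with x hx
  rw [← eLpNorm_exponent_top] at hx
  simpa [linfNorm] using ENNReal.toReal_mono hg hx

namespace Param

variable {d N : ℕ} {P : Param d N}

/-! ### The transformation and its Jacobian -/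

theorem F_zero (x : E d) : P.F x 0 = x := by simp [F]

theorem D_zero : P.D 0 = P.U := by simp [D, F_zero]

theorem jac_zero (x : E d) : P.jac x 0 = 1 := by
  ext1 v
  simp [jac]

theorem F_sub (x : E d) (y y' : Fin N → ℝ) :
    P.F x y - P.F x y' = (∑ l, Real.sqrt (P.mu l) * P.b l x * (y l - y' l)) • P.vhat x := by
  simp only [F, add_sub_add_left_eq_sub, ← sub_smul, ← Finset.sum_sub_distrib, mul_sub]

theorem jac_sub (x : E d) (y y' : Fin N → ℝ) :
    P.jac x y - P.jac x y' = ∑ l, (Real.sqrt (P.mu l) * (y l - y' l)) • P.B l x := by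
  simp only [jac, add_sub_add_left_eq_sub, ← Finset.sum_sub_distrib, mul_sub]
  exact Finset.sum_congr rfl fun l _ => by module

theorem norm_F_sub_le (x : E d) (y y' : Fin N → ℝ) :
    ‖P.F x y - P.F x y'‖ ≤
      (∑ l, |y l - y' l| * (Real.sqrt (P.mu l) * |P.b l x|)) * ‖P.vhat x‖ := by
  rw [F_sub, norm_smul]
  gcongr
  refine (norm_sum_le _ _).trans (Finset.sum_le_sum fun l _ => le_of_eq ?_)
  rw [norm_mul, norm_mul, Real.norm_eq_abs, Real.norm_eq_abs, Real.norm_eq_abs,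
    abs_of_nonneg (Real.sqrt_nonneg _)]
  ring

theorem norm_jac_sub_le (x : E d) (y y' : Fin N → ℝ) :
    ‖P.jac x y - P.jac x y'‖ ≤ ∑ l, |y l - y' l| * (Real.sqrt (P.mu l) * ‖P.B l x‖) := by
  rw [jac_sub]
  refine (norm_sum_le _ _).trans (Finset.sum_le_sum fun l _ => le_of_eq ?_)
  rw [norm_smul, norm_mul, Real.norm_eq_abs, Real.norm_eq_abs,
    abs_of_nonneg (Real.sqrt_nonneg _)]
  ring

theorem F_mem_G {x : E d} (hx : x ∈ P.U) {y : Fin N → ℝ} (hy : y ∈ Gam N) : P.F x y ∈ P.G :=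
  mem_iUnion₂.2 ⟨y, hy, x, hx, rfl⟩

/-- $F(x,\cdot)$ is affine, so it maps the segment $[y,y']\subseteq\Gamma$ onto this one. -/
theorem segment_F_subset_G {x : E d} (hx : x ∈ P.U) {y y' : Fin N → ℝ} (hy : y ∈ Gam N)
    (hy' : y' ∈ Gam N) : segment ℝ (P.F x y) (P.F x y') ⊆ P.G := by
  rintro _ ⟨s, t, hs, ht, hst, rfl⟩
  have : s • P.F x y + t • P.F x y' = P.F x (s • y + t • y') := by
    have h1 : (∑ l, Real.sqrt (P.mu l) * P.b l x * (s • y + t • y') l)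
        = s * (∑ l, Real.sqrt (P.mu l) * P.b l x * y l)
          + t * (∑ l, Real.sqrt (P.mu l) * P.b l x * y' l) := by
      simp only [Finset.mul_sum, ← Finset.sum_add_distrib, Pi.add_apply, Pi.smul_apply,
        smul_eq_mul]
      exact Finset.sum_congr rfl fun l _ => by ring
    have h2 : ∀ A B : ℝ, s • (x + A • P.vhat x) + t • (x + B • P.vhat x)
        = (s + t) • x + (s * A + t * B) • P.vhat x := fun A B => by module
    rw [F, F, F, h1, h2, hst, one_smul]
  rw [this]
  exact F_mem_G hx (convex_Gam hy hy' hs ht hst)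

/-! ### Pointwise bounds and measurability from the regularity assumptions -/

theorem Regular.measurableSet (hP : P.Regular) : MeasurableSet P.U := hP.isOpen.measurableSet

theorem Regular.volume_lt_top (hP : P.Regular) : volume P.U < ⊤ := hP.bounded.measure_lt_top

theorem Regular.ae_mem (hP : P.Regular) : ∀ᵐ x ∂(volume.restrict P.U), x ∈ P.U :=
  ae_restrict_mem hP.measurableSet

theorem Regular.ae_abs_b_le (hP : P.Regular) (l : Fin N) :
    ∀ᵐ x ∂(volume.restrict P.U), |P.b l x| ≤ linfNorm P.U (P.b l) := by
  filter_upwards [ae_norm_le_linfNorm (hP.b_memLp l).eLpNorm_ne_top] with x hx using hx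

/-- By continuity the set where $|b_l|>1$ is open, and it is null, so it is empty. A bound at every
point is needed because $\mathcal G$ contains the images of all points of $U$. -/
theorem Regular.abs_b_le_one (hP : P.Regular) (l : Fin N) {x : E d} (hx : x ∈ P.U) :
    |P.b l x| ≤ 1 := by
  by_contra hlt
  have ho : IsOpen (P.U ∩ P.b l ⁻¹' {t | 1 < |t|}) :=
    (hP.b_cont l).isOpen_inter_preimage hP.isOpen (isOpen_lt continuous_const continuous_abs)
  have hz : volume (P.U ∩ P.b l ⁻¹' {t | 1 < |t|}) = 0 := by
    have h := hP.ae_abs_b_le l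
    rw [hP.b_norm l, ae_restrict_iff' hP.measurableSet] at h
    refine measure_mono_null ?_ (ae_iff.1 h)
    rintro z ⟨hz1, hz2⟩
    simp only [mem_ofPred_eq, Classical.not_imp, not_le]
    exact ⟨hz1, hz2⟩
  have := (ho.measure_eq_zero_iff volume).1 hz
  exact (this ▸ (⟨hx, not_le.1 hlt⟩ : x ∈ P.U ∩ P.b l ⁻¹' {t | 1 < |t|}) : x ∈ (∅ : Set (E d)))

theorem Regular.isBounded_G (hP : P.Regular) : Bornology.IsBounded P.G := by
  obtain ⟨R, -, hR⟩ := hP.bounded.exists_pos_norm_le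
  obtain ⟨K, hK⟩ := hP.vhat_bdd
  refine isBounded_iff_forall_norm_le.2 ⟨R + (∑ l, 1 * (Real.sqrt (P.mu l) * 1)) * K, ?_⟩
  intro z hz
  obtain ⟨y, hy, x, hx, rfl⟩ := mem_iUnion₂.1 hz
  have h1 : P.F x y = x + (P.F x y - P.F x 0) := by rw [F_zero]; abel
  change ‖P.F x y‖ ≤ _
  rw [h1]
  refine (norm_add_le _ _).trans (add_le_add (hR x hx) ((norm_F_sub_le x y 0).trans ?_))
  have hK0 : 0 ≤ K := (norm_nonneg _).trans (hK x hx)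
  refine mul_le_mul (Finset.sum_le_sum fun l _ => ?_) (hK x hx) (norm_nonneg _) (by positivity)
  have h2 := abs_le_one_of_mem_Gam hy l
  have h3 := hP.abs_b_le_one l hx
  simp only [Pi.zero_apply, sub_zero]
  gcongr

theorem Regular.ae_norm_vhat_le (hP : P.Regular) :
    ∀ᵐ x ∂(volume.restrict P.U), ‖P.vhat x‖ ≤ linfNorm P.U P.vhat := by
  have hm : MemLp P.vhat ∞ (volume.restrict P.U) := by
    obtain ⟨K, hK⟩ := hP.vhat_bdd
    refine memLp_top_of_bound
      (hP.vhat_C1.continuousOn.aestronglyMeasurable hP.measurableSet) K ?_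
    filter_upwards [hP.ae_mem] with x hx using hK x hx
  exact ae_norm_le_linfNorm hm.eLpNorm_ne_top

theorem Regular.aestronglyMeasurable_B (hP : P.Regular) (l : Fin N) :
    AEStronglyMeasurable (P.B l) (volume.restrict P.U) := by
  have h1 : AEStronglyMeasurable (P.b l) (volume.restrict P.U) := (hP.b_memLp l).1
  have h2 : AEStronglyMeasurable (fderiv ℝ P.vhat) (volume.restrict P.U) :=
    (measurable_fderiv ℝ P.vhat).aestronglyMeasurable
  have h3 : AEStronglyMeasurable P.vhat (volume.restrict P.U) :=
    hP.vhat_C1.continuousOn.aestronglyMeasurable hP.measurableSet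
  have h4 : AEStronglyMeasurable (fun x => innerSL ℝ (P.gradb l x)) (volume.restrict P.U) :=
    (innerSL ℝ).continuous.comp_aestronglyMeasurable (hP.gradb_memLp l).1
  refine (h1.smul h2).add ?_
  exact (ContinuousLinearMap.smulRightL ℝ (E d) (E d)).aestronglyMeasurable_comp₂ h4 h3

theorem Regular.aestronglyMeasurable_jac (hP : P.Regular) (y : Fin N → ℝ) :
    AEStronglyMeasurable (fun x => P.jac x y) (volume.restrict P.U) := by
  unfold jac
  refine aestronglyMeasurable_const.add ?_
  refine Finset.aestronglyMeasurable_fun_sum _ fun l _ => ?_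
  exact (hP.aestronglyMeasurable_B l).const_smul (Real.sqrt (P.mu l) * y l)

theorem Regular.aestronglyMeasurable_F (hP : P.Regular) (y : Fin N → ℝ) :
    AEStronglyMeasurable (fun x => P.F x y) (volume.restrict P.U) := by
  unfold F
  suffices h : AEStronglyMeasurable (fun x => ∑ l, Real.sqrt (P.mu l) * P.b l x * y l)
      (volume.restrict P.U) by
    exact aestronglyMeasurable_id.add (h.smul
      (hP.vhat_C1.continuousOn.aestronglyMeasurable hP.measurableSet))
  refine Finset.aestronglyMeasurable_fun_sum _ fun l _ => ?_
  exact (((hP.b_memLp l).1.const_mul _).mul_const _)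

theorem Regular.aestronglyMeasurable_pullbackMatrix (hP : P.Regular) (y : Fin N → ℝ) :
    AEStronglyMeasurable (fun x => pullbackMatrix (P.jac x y)) (volume.restrict P.U) :=
  (measurable_pullbackMatrix.comp_aemeasurable
    (hP.aestronglyMeasurable_jac y).aemeasurable).aestronglyMeasurable

theorem Regular.memLp_f_comp_F (hP : P.Regular) {f : E d → ℝ} (hf : ContDiff ℝ 1 f)
    {y : Fin N → ℝ} (hy : y ∈ Gam N) :
    MemLp (fun x => f (P.F x y)) 2 (volume.restrict P.U) := by
  have : IsFiniteMeasure (volume.restrict P.U) := ⟨by simpa using hP.volume_lt_top⟩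
  refine MemLp.of_bound
    (hf.continuous.comp_aestronglyMeasurable (hP.aestronglyMeasurable_F y))
    (c1Norm P.G f).toReal ?_
  filter_upwards [hP.ae_mem] with x hx
  exact norm_le_c1Norm (c1Norm_lt_top hf hP.isBounded_G) (F_mem_G hx hy)

/-! ### The diffusion coefficient -/

section Coefficient

variable {a : E d → (Fin N → ℝ) → ℝ} {amin amax : ℝ}

/-- Comparison with $y=0$, where $F$ is the identity and $D(0)=U$, brings measurability and bounds
of $a$ to $U$ without transporting null sets through $F$. -/
theorem Coefficient.ae_eq (ha : P.Coefficient a amin amax) {y : Fin N → ℝ} (hy : y ∈ Gam N) :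
    ∀ᵐ x ∂(volume.restrict P.U), a (P.F x y) y = a x 0 := by
  filter_upwards [ha.indep y hy 0 zero_mem_Gam] with x hx
  rw [hx, F_zero]

theorem Coefficient.ae_bounds (ha : P.Coefficient a amin amax) :
    ∀ᵐ x ∂(volume.restrict P.U), amin ≤ a x 0 ∧ a x 0 ≤ amax := by
  have := ha.bounds 0 zero_mem_Gam
  rwa [D_zero] at this

theorem Coefficient.aestronglyMeasurable (ha : P.Coefficient a amin amax) :
    AEStronglyMeasurable (fun x => a x 0) (volume.restrict P.U) := by
  have := ha.meas 0 zero_mem_Gam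
  rwa [D_zero] at this

/-! ### The bilinear form -/

theorem Coefficient.bform_eq (ha : P.Coefficient a amin amax) {y : Fin N → ℝ} (hy : y ∈ Gam N)
    (s v : L2Pair P.U) :
    P.bform a y s v
      = ∫ x in P.U, a x 0 * ⟪s.snd x, pullbackMatrix (P.jac x y) (v.snd x)⟫_ℝ := by
  refine integral_congr_ae ?_
  filter_upwards [ha.ae_eq hy] with x hx
  rw [hx, pullbackMatrix, smul_apply, inner_smul_right, C]
  ring

theorem Regular.integrable_bform (hP : P.Regular) (ha : P.Coefficient a amin amax)
    {Fmin Fmax : ℝ} (hF : P.JacobianBounds Fmin Fmax) {y : Fin N → ℝ} (hy : y ∈ Gam N)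
    (s v : L2Pair P.U) :
    Integrable (fun x => a x 0 * ⟪s.snd x, pullbackMatrix (P.jac x y) (v.snd x)⟫_ℝ)
      (volume.restrict P.U) := by
  refine integrable_of_abs_le_mul (K := amax * (Fmax ^ d * Fmin⁻¹ ^ 2))
    (Lp.memLp s.snd) (Lp.memLp v.snd) ?_ ?_
  · refine ha.aestronglyMeasurable.mul (AEStronglyMeasurable.inner (Lp.aestronglyMeasurable _) ?_)
    exact (ContinuousLinearMap.id ℝ (E d →L[ℝ] E d)).aestronglyMeasurable_comp₂
      (hP.aestronglyMeasurable_pullbackMatrix y) (Lp.aestronglyMeasurable _)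
  · filter_upwards [ha.ae_bounds, hF.lower y hy, hF.upper y hy] with x h1 h2 h3
    have h4 := norm_pullbackMatrix_le hF.pos h2 h3
    have h5 : 0 ≤ a x 0 := ha.pos.le.trans h1.1
    rw [abs_mul, abs_of_nonneg h5]
    have h6 : |⟪s.snd x, pullbackMatrix (P.jac x y) (v.snd x)⟫_ℝ|
        ≤ (Fmax ^ d * Fmin⁻¹ ^ 2) * (‖s.snd x‖ * ‖v.snd x‖) := by
      refine (abs_real_inner_le_norm _ _).trans ?_
      calc _ ≤ ‖s.snd x‖ * ((Fmax ^ d * Fmin⁻¹ ^ 2) * ‖v.snd x‖) := by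
            gcongr
            exact (ContinuousLinearMap.le_opNorm _ _).trans (by gcongr)
        _ = _ := by ring
    rw [mul_assoc]
    exact mul_le_mul h1.2 h6 (abs_nonneg _) (h5.trans h1.2)

theorem Regular.bform_add_left (hP : P.Regular) (ha : P.Coefficient a amin amax)
    {Fmin Fmax : ℝ} (hF : P.JacobianBounds Fmin Fmax) {y : Fin N → ℝ} (hy : y ∈ Gam N)
    (s s' v : L2Pair P.U) :
    P.bform a y (s + s') v = P.bform a y s v + P.bform a y s' v := by
  rw [ha.bform_eq hy, ha.bform_eq hy, ha.bform_eq hy,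
    ← integral_add (hP.integrable_bform ha hF hy s v) (hP.integrable_bform ha hF hy s' v)]
  refine integral_congr_ae ?_
  filter_upwards [Lp.coeFn_add s.snd s'.snd] with x hx
  have : (s + s').snd x = s.snd x + s'.snd x := hx
  rw [this, inner_add_left]
  ring

theorem Regular.coercive_bform (hP : P.Regular) (ha : P.Coefficient a amin amax)
    {Fmin Fmax : ℝ} (hF : P.JacobianBounds Fmin Fmax) (hM : 0 < Fmax)
    {y : Fin N → ℝ} (hy : y ∈ Gam N) (v : L2Pair P.U) :
    amin * Fmin ^ d * Fmax⁻¹ ^ 2 * ‖v.snd‖ ^ 2 ≤ P.bform a y v v := by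
  rw [ha.bform_eq hy, norm_sq_eq_integral, ← integral_const_mul]
  refine integral_mono_ae ((Lp.memLp v.snd).integrable_norm_pow (by simp) |>.const_mul _)
    (hP.integrable_bform ha hF hy v v) ?_
  filter_upwards [ha.ae_bounds, hF.lower y hy, hF.upper y hy] with x h1 h2 h3
  have h4 := pullbackMatrix_coercive hF.pos hM h2 h3 (v.snd x)
  have := hF.pos
  calc _ = amin * (Fmin ^ d * Fmax⁻¹ ^ 2 * ‖v.snd x‖ ^ 2) := by ring
    _ ≤ _ := mul_le_mul h1.1 h4 (by positivity) (ha.pos.le.trans h1.1)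

theorem Regular.abs_bform_sub_le (hP : P.Regular) (ha : P.Coefficient a amin amax)
    {Fmin Fmax : ℝ} (hF : P.JacobianBounds Fmin Fmax) (hM : 0 ≤ Fmax) (hamax : 0 ≤ amax)
    {y y' : Fin N → ℝ} (hy : y ∈ Gam N) (hy' : y' ∈ Gam N) {β : ℝ} (hβ : 0 ≤ β)
    (hyy : ∀ᵐ x ∂(volume.restrict P.U), ‖P.jac x y - P.jac x y'‖ ≤ β) (s v : L2Pair P.U) :
    |P.bform a y s v - P.bform a y' s v| ≤
      amax * ((2 * Fmax ^ d * Fmin⁻¹ ^ 3 + d * Fmax ^ (d - 1) * Fmin⁻¹ ^ 2) * β)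
        * (‖s.snd‖ * ‖v.snd‖) := by
  have hm := hF.pos
  rw [ha.bform_eq hy, ha.bform_eq hy',
    ← integral_sub (hP.integrable_bform ha hF hy s v) (hP.integrable_bform ha hF hy' s v),
    Lp.norm_def, Lp.norm_def]
  refine abs_integral_le_mul (by positivity) (Lp.memLp _) (Lp.memLp _) ?_
  filter_upwards [ha.ae_bounds, hF.lower y hy, hF.upper y hy, hF.lower y' hy', hF.upper y' hy',
    hyy] with x h1 h2 h3 h4 h5 h6
  have h7 := norm_pullbackMatrix_sub_le hF.pos h2 h4 h3 h5
  have h8 : 0 ≤ a x 0 := ha.pos.le.trans h1.1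
  rw [← mul_sub, ← inner_sub_right, ← sub_apply, abs_mul, abs_of_nonneg h8, mul_assoc]
  refine mul_le_mul h1.2 ?_ (abs_nonneg _) hamax
  refine (abs_real_inner_le_norm _ _).trans ?_
  calc _ ≤ ‖s.snd x‖ * (((2 * Fmax ^ d * Fmin⁻¹ ^ 3 + d * Fmax ^ (d - 1) * Fmin⁻¹ ^ 2) * β)
            * ‖v.snd x‖) := by
        gcongr
        refine (ContinuousLinearMap.le_opNorm _ _).trans ?_
        gcongr
        exact h7.trans (by gcongr)
    _ = _ := by ring

end Coefficient

/-! ### The load -/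

theorem Regular.integrable_load (hP : P.Regular) {f : E d → ℝ} (hf : ContDiff ℝ 1 f)
    {Fmin Fmax : ℝ} (hF : P.JacobianBounds Fmin Fmax) {y : Fin N → ℝ} (hy : y ∈ Gam N)
    (v : L2Pair P.U) :
    Integrable (fun x => f (P.F x y) * |(P.jac x y).det| * v.fst x) (volume.restrict P.U) := by
  have hdet : AEStronglyMeasurable (fun x => |(P.jac x y).det|) (volume.restrict P.U) :=
    ContinuousLinearMap.continuous_det.abs.comp_aestronglyMeasurable
      (hP.aestronglyMeasurable_jac y)
  refine integrable_of_abs_le_mul (K := Fmax ^ d) (hP.memLp_f_comp_F hf hy) (Lp.memLp v.fst)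
    (((hP.memLp_f_comp_F hf hy).1.mul hdet).mul (Lp.aestronglyMeasurable _)) ?_
  filter_upwards [hF.upper y hy] with x hx
  have h1 : |(P.jac x y).det| ≤ Fmax ^ d := (abs_det_le _).trans (by gcongr)
  rw [abs_mul, abs_mul, abs_abs, Real.norm_eq_abs, Real.norm_eq_abs]
  calc _ = |(P.jac x y).det| * (|f (P.F x y)| * |v.fst x|) := by ring
    _ ≤ _ := by gcongr

theorem Regular.abs_load_sub_le (hP : P.Regular) {f : E d → ℝ} (hf : ContDiff ℝ 1 f)
    {Fmin Fmax : ℝ} (hF : P.JacobianBounds Fmin Fmax) (hM : 0 ≤ Fmax)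
    {y y' : Fin N → ℝ} (hy : y ∈ Gam N) (hy' : y' ∈ Gam N) {β γ : ℝ} (hβ : 0 ≤ β) (hγ : 0 ≤ γ)
    (hyy : ∀ᵐ x ∂(volume.restrict P.U), ‖P.jac x y - P.jac x y'‖ ≤ β)
    (hfy : ∀ᵐ x ∂(volume.restrict P.U), ‖f (P.F x y) - f (P.F x y')‖ ≤ γ) (v : L2Pair P.U) :
    |(∫ x in P.U, f (P.F x y) * |(P.jac x y).det| * v.fst x)
        - ∫ x in P.U, f (P.F x y') * |(P.jac x y').det| * v.fst x| ≤
      (d * Fmax ^ (d - 1) * β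
          * (eLpNorm (fun x => f (P.F x y)) 2 (volume.restrict P.U)).toReal
        + Fmax ^ d * γ * Real.sqrt (volume P.U).toReal) * ‖v.fst‖ := by
  have : IsFiniteMeasure (volume.restrict P.U) := ⟨by simpa using hP.volume_lt_top⟩
  have hdet : ∀ y, AEStronglyMeasurable (fun x => |(P.jac x y).det|) (volume.restrict P.U) :=
    fun y => ContinuousLinearMap.continuous_det.abs.comp_aestronglyMeasurable
      (hP.aestronglyMeasurable_jac y)
  have hfF := hP.memLp_f_comp_F hf hy
  -- Cauchy-Schwarz against the constant $1$ produces the factor $|U|^{1/2}=\|\chi_U\|_{L^2}$.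
  have hone : MemLp (fun _ : E d => (1 : ℝ)) 2 (volume.restrict P.U) := memLp_const _
  have hone_norm : (eLpNorm (fun _ : E d => (1 : ℝ)) 2 (volume.restrict P.U)).toReal
      = Real.sqrt (volume P.U).toReal := by
    rw [eLpNorm_const' _ (by simp) (by simp)]
    simp [← ENNReal.toReal_rpow, Real.sqrt_eq_rpow]
  -- The splitting keeps $f\circ F$ at $y$ in `g₁` and the determinant at $y'$ in `g₂`, so that only
  -- the norm of $f\circ F$ at $y$ enters the estimate.
  set g₁ : E d → ℝ := fun x =>
    f (P.F x y) * (|(P.jac x y).det| - |(P.jac x y').det|) * v.fst x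
  set g₂ : E d → ℝ := fun x =>
    (f (P.F x y) - f (P.F x y')) * |(P.jac x y').det| * v.fst x
  have b₁ : ∀ᵐ x ∂(volume.restrict P.U),
      |g₁ x| ≤ (d * Fmax ^ (d - 1) * β) * (‖f (P.F x y)‖ * ‖v.fst x‖) := by
    filter_upwards [hF.upper y hy, hF.upper y' hy', hyy] with x h1 h2 h3
    have h4 : |(|(P.jac x y).det| - |(P.jac x y').det|)| ≤ d * Fmax ^ (d - 1) * β :=
      (abs_abs_sub_abs_le_abs_sub _ _).trans ((abs_det_sub_le h1 h2).trans (by gcongr))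
    simp only [g₁]
    rw [abs_mul, abs_mul, Real.norm_eq_abs, Real.norm_eq_abs]
    calc _ = |(|(P.jac x y).det| - |(P.jac x y').det|)| * (|f (P.F x y)| * |v.fst x|) := by ring
      _ ≤ _ := by gcongr
  have b₂ : ∀ᵐ x ∂(volume.restrict P.U),
      |g₂ x| ≤ (Fmax ^ d * γ) * (‖(1 : ℝ)‖ * ‖v.fst x‖) := by
    filter_upwards [hF.upper y' hy', hfy] with x h1 h2
    have h3 : |(P.jac x y').det| ≤ Fmax ^ d := (abs_det_le _).trans (by gcongr)
    simp only [g₂]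
    rw [Real.norm_eq_abs] at h2
    rw [abs_mul, abs_mul, abs_abs, norm_one, one_mul, Real.norm_eq_abs, mul_comm (Fmax ^ d)]
    gcongr
  have i₁ : Integrable g₁ (volume.restrict P.U) :=
    integrable_of_abs_le_mul hfF (Lp.memLp v.fst)
      ((hfF.1.mul ((hdet y).sub (hdet y'))).mul (Lp.aestronglyMeasurable _)) b₁
  have i₂ : Integrable g₂ (volume.restrict P.U) :=
    integrable_of_abs_le_mul hone (Lp.memLp v.fst)
      (((hfF.1.sub (hP.memLp_f_comp_F hf hy').1).mul (hdet y')).mul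
        (Lp.aestronglyMeasurable _)) b₂
  have e : (∫ x in P.U, f (P.F x y) * |(P.jac x y).det| * v.fst x)
        - ∫ x in P.U, f (P.F x y') * |(P.jac x y').det| * v.fst x
      = (∫ x in P.U, g₁ x) + ∫ x in P.U, g₂ x := by
    rw [← integral_sub (hP.integrable_load hf hF hy v) (hP.integrable_load hf hF hy' v),
      ← integral_add i₁ i₂]
    refine integral_congr_ae (ae_of_all _ fun x => ?_)
    simp only [g₁, g₂]
    ring
  have n₁ := abs_integral_le_mul (by positivity) hfF (Lp.memLp v.fst) b₁
  have n₂ := abs_integral_le_mul (by positivity) hone (Lp.memLp v.fst) b₂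
  rw [hone_norm, ← Lp.norm_def] at n₂
  rw [← Lp.norm_def] at n₁
  rw [e]
  refine (abs_add_le _ _).trans ((add_le_add n₁ n₂).trans (le_of_eq ?_))
  ring


/-! ### Stability of the solution with respect to the parameter -/

/-- At $y=0$ the Jacobian is the identity; a set of positive measure supplies a point where both
bounds hold. -/
theorem JacobianBounds.le_one (hd : 0 < d) {Fmin Fmax : ℝ} (hF : P.JacobianBounds Fmin Fmax)
    (hU : volume P.U ≠ 0) : Fmin ≤ 1 ∧ 1 ≤ Fmax := by
  have : (ae (volume.restrict P.U)).NeBot := by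
    rw [ae_neBot]; simpa using hU
  obtain ⟨x, h1, h2⟩ := ((hF.lower 0 zero_mem_Gam).and (hF.upper 0 zero_mem_Gam)).exists
  have h3 := h1 (EuclideanSpace.single ⟨0, hd⟩ 1)
  have h4 := norm_apply_basisFun_le (P.jac x 0) ⟨0, hd⟩
  rw [jac_zero] at h2 h3 h4
  simp only [one_apply_eq_self, PiLp.norm_single, norm_one, mul_one] at h3
  simp only [one_apply_eq_self, EuclideanSpace.basisFun_apply, PiLp.norm_single,
    norm_one] at h4
  exact ⟨h3, h4.trans h2⟩

theorem Coefficient.amax_nonneg {a : E d → (Fin N → ℝ) → ℝ} {amin amax : ℝ}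
    (ha : P.Coefficient a amin amax) (hU : volume P.U ≠ 0) : 0 ≤ amax := by
  have : (ae (volume.restrict P.U)).NeBot := by
    rw [ae_neBot]; simpa using hU
  obtain ⟨x, h1, h2⟩ := ha.ae_bounds.exists
  exact ha.pos.le.trans (h1.trans h2)

/-- The algebra behind the stability estimate: `X` and `Y` stand for the perturbations of the
bilinear form and of the load. -/
theorem le_of_coercive_of_le {c CP X Y e g : ℝ} (hc : 0 < c) (hX : 0 ≤ X) (hY : 0 ≤ Y)
    (hg : 0 ≤ g) (hCP : 1 ≤ CP) (he : e ≤ CP * g) (h : c * g ^ 2 ≤ X * g + Y * e) :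
    e ≤ CP ^ 2 / c * (X + CP * Y) := by
  have h1 : c * g ≤ X + CP * Y := by
    rcases hg.eq_or_lt with h0 | h0
    · rw [← h0, mul_zero]; positivity
    · have h2 : g * (c * g) ≤ g * (X + CP * Y) := by nlinarith
      exact le_of_mul_le_mul_left h2 h0
  have h3 : g ≤ (X + CP * Y) / c := by
    rw [le_div_iff₀ hc]; linarith
  have h4 : 0 ≤ X + CP * Y := by positivity
  calc e ≤ CP * ((X + CP * Y) / c) := he.trans (by gcongr)
    -- The argument yields only one factor `CP`; the second is slack, allowed by `CP ≥ 1`.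
    _ ≤ CP ^ 2 * ((X + CP * Y) / c) := by
        gcongr
        nlinarith
    _ = _ := by ring

/-- Expanded, $H=2M^dm^{-3}+M^dm^{-4}(1-\delta)+dM^{d-1}m^{-4}$. The middle term is slack, and
$m^{-2}\le m^{-4}$ as $m\le1$. -/
theorem le_Hconst (hd : 0 < d) {m M δ : ℝ} (hm : 0 < m) (hm1 : m ≤ 1) (hM : 0 ≤ M)
    (hδ : δ ≤ 1) :
    2 * M ^ d * m⁻¹ ^ 3 + d * M ^ (d - 1) * m⁻¹ ^ 2 ≤ Hconst M m δ d := by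
  have e : Hconst M m δ d = 2 * M ^ d * m⁻¹ ^ 3 + M ^ d * m⁻¹ ^ 4 * (1 - δ)
      + d * M ^ (d - 1) * m⁻¹ ^ 4 := by
    rw [Hconst, ← Nat.sub_add_cancel (Nat.one_le_iff_ne_zero.2 hd.ne'), pow_succ]
    simp only [Nat.add_sub_cancel]
    ring
  have h1 : 1 ≤ m⁻¹ := (one_le_inv₀ hm).2 hm1
  have h2 : m⁻¹ ^ 2 ≤ m⁻¹ ^ 4 := pow_le_pow_right₀ h1 (by norm_num)
  have h3 : 0 ≤ M ^ d * m⁻¹ ^ 4 * (1 - δ) := by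
    have : 0 ≤ 1 - δ := by linarith
    positivity
  have h4 : d * M ^ (d - 1) * m⁻¹ ^ 2 ≤ d * M ^ (d - 1) * m⁻¹ ^ 4 := by gcongr
  rw [e]
  linarith

theorem Hconst_nonneg {m M δ : ℝ} (hm : 0 ≤ m) (hM : 0 ≤ M) (hδ : δ ≤ 1) :
    0 ≤ Hconst M m δ d := by
  have : 0 ≤ 1 - δ := by linarith
  unfold Hconst
  positivity

theorem Cconst_nonneg {CP amin m M : ℝ} (ha : 0 ≤ amin) (hm : 0 ≤ m) :
    0 ≤ Cconst CP amin m M d := by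
  unfold Cconst
  positivity

/-- If `‖∂F(·,y) - ∂F(·,y')‖ ≤ β` and `|f ∘ F(·,y) - f ∘ F(·,y')| ≤ γ`, then the solutions for
`y` and `y'` differ by at most a constant times `β` plus a constant times `γ`. -/
theorem Regular.norm_solution_sub_le (hd : 0 < d) (hP : P.Regular) (hU : volume P.U ≠ 0)
    {Fmin Fmax : ℝ} (hF : P.JacobianBounds Fmin Fmax)
    {a : E d → (Fin N → ℝ) → ℝ} {amin amax : ℝ} (ha : P.Coefficient a amin amax)
    {δ : ℝ} (hδ : δ ≤ 1) {f : E d → ℝ} (hf : ContDiff ℝ 1 f) (w : L2Pair P.U)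
    {y y' : Fin N → ℝ} (hy : y ∈ Gam N) (hy' : y' ∈ Gam N) {u u' : H10 P.U}
    (hu : P.IsSolution a f w y u) (hu' : P.IsSolution a f w y' u')
    {β γ : ℝ} (hβ : 0 ≤ β) (hγ : 0 ≤ γ)
    (hyy : ∀ᵐ x ∂(volume.restrict P.U), ‖P.jac x y - P.jac x y'‖ ≤ β)
    (hfy : ∀ᵐ x ∂(volume.restrict P.U), ‖f (P.F x y) - f (P.F x y')‖ ≤ γ) :
    ‖u - u'‖ ≤
      Cconst (poincareConst P.U) amin Fmin Fmax d *
        (poincareConst P.U * Fmax ^ (d - 1) * Fmin⁻¹ ^ 2 * d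
            * (eLpNorm (fun x => f (P.F x y)) 2 (volume.restrict P.U)).toReal
          + amax * Hconst Fmax Fmin δ d * ‖w‖ + amax * Hconst Fmax Fmin δ d * ‖u‖) * β
      + Cconst (poincareConst P.U) amin Fmin Fmax d * Fmax ^ d * poincareConst P.U
          * Real.sqrt (volume P.U).toReal * γ := by
  obtain ⟨hm1, hM1⟩ := hF.le_one hd hU
  have hm := hF.pos
  have hM : 0 < Fmax := by linarith
  have hamax := ha.amax_nonneg hU
  have hCP0 : 0 ≤ poincareConst P.U := poincareConst_nonneg
  have hH0 := Hconst_nonneg (d := d) hm.le hM.le hδ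
  have hC0 := Cconst_nonneg (d := d) (CP := poincareConst P.U) (M := Fmax) ha.pos.le hm.le
  set e : L2Pair P.U := ((u - u' : H10 P.U) : L2Pair P.U) with he
  have heH : e ∈ H10 P.U := (u - u').2
  change ‖e‖ ≤ _
  -- Treated apart because $C_P\ge1$ is available only when $H^1_0$ has a nonzero element.
  by_cases h0 : e = 0
  · rw [h0, norm_zero]
    positivity
  have hCP := one_le_poincareConst hd hP.isOpen hP.bounded heH h0
  have hpoin := norm_le_poincareConst hd hP.isOpen hP.bounded heH
  -- Coercivity is taken at $y'$, so that the perturbed form acts on $u$ and the final bound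
  -- contains $\|u\|$ rather than $\|u'\|$.
  have hcoer := hP.coercive_bform ha hF hM hy' e
  set fF := (eLpNorm (fun x => f (P.F x y)) 2 (volume.restrict P.U)).toReal
  have hfF : 0 ≤ fF := ENNReal.toReal_nonneg
  set H₀ := 2 * Fmax ^ d * Fmin⁻¹ ^ 3 + d * Fmax ^ (d - 1) * Fmin⁻¹ ^ 2
  have hH : H₀ ≤ Hconst Fmax Fmin δ d := le_Hconst hd hm hm1 hM.le hδ
  have hH₀ : 0 ≤ H₀ := by positivity
  have hload := hP.abs_load_sub_le hf hF hM.le hy hy' hβ hγ hyy hfy e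
  -- The lifting and the solution enter through the same form, so their sum is estimated at once.
  have hbu := hP.abs_bform_sub_le ha hF hM.le hamax hy hy' hβ hyy ((u : L2Pair P.U) + w) e
  have s1 := hu (u - u')
  have s2 := hu' (u - u')
  simp only [lform] at s1 s2
  rw [← he] at s1 s2
  have s3 : P.bform a y' e e = P.bform a y' u e - P.bform a y' u' e := by
    have : (u : L2Pair P.U) = e + (u' : L2Pair P.U) := by rw [he]; simp
    rw [this, hP.bform_add_left ha hF hy']
    ring
  rw [hP.bform_add_left ha hF hy, hP.bform_add_left ha hF hy'] at hbu
  have hwu : ‖((u : L2Pair P.U) + w).snd‖ ≤ ‖w‖ + ‖u‖ := by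
    refine (norm_snd_le _).trans ((norm_add_le _ _).trans (le_of_eq ?_))
    rw [add_comm]; rfl
  set X := amax * (H₀ * β) * (‖w‖ + ‖u‖)
  set Y := d * Fmax ^ (d - 1) * β * fF + Fmax ^ d * γ * Real.sqrt (volume P.U).toReal
  have hX : 0 ≤ X := by positivity
  have hY : 0 ≤ Y := by positivity
  have hbu' : |P.bform a y u e + P.bform a y w e - (P.bform a y' u e + P.bform a y' w e)|
      ≤ X * ‖e.snd‖ := by
    refine hbu.trans ?_
    rw [← mul_assoc]
    gcongr
    exact mul_le_mul_of_nonneg_left hwu (by positivity)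
  have hload' := hload.trans (mul_le_mul_of_nonneg_left (norm_fst_le e) hY)
  have key : amin * Fmin ^ d * Fmax⁻¹ ^ 2 * ‖e.snd‖ ^ 2 ≤ X * ‖e.snd‖ + Y * ‖e‖ := by
    refine hcoer.trans ?_
    rw [s3]
    have t1 := neg_le_of_abs_le hbu'
    have t2 := le_of_abs_le hload'
    linarith
  have hpos := ha.pos
  refine (le_of_coercive_of_le (by positivity) hX hY (norm_nonneg _) hCP hpoin key).trans ?_
  change Cconst (poincareConst P.U) amin Fmin Fmax d * _ ≤ _
  have f1 : X ≤ amax * Hconst Fmax Fmin δ d * (‖w‖ + ‖u‖) * β := by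
    calc X = amax * H₀ * (‖w‖ + ‖u‖) * β := by ring
      _ ≤ _ := by gcongr
  have f2 : poincareConst P.U * Y ≤
      poincareConst P.U * Fmax ^ (d - 1) * Fmin⁻¹ ^ 2 * d * fF * β
        + Fmax ^ d * poincareConst P.U * Real.sqrt (volume P.U).toReal * γ := by
    have h1 : 1 ≤ Fmin⁻¹ ^ 2 := one_le_pow₀ ((one_le_inv₀ hm).2 hm1)
    have h2 : poincareConst P.U * (d * Fmax ^ (d - 1) * β * fF) * 1
        ≤ poincareConst P.U * (d * Fmax ^ (d - 1) * β * fF) * Fmin⁻¹ ^ 2 := by gcongr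
    simp only [Y]
    linarith
  calc _ ≤ Cconst (poincareConst P.U) amin Fmin Fmax d *
        (amax * Hconst Fmax Fmin δ d * (‖w‖ + ‖u‖) * β
          + (poincareConst P.U * Fmax ^ (d - 1) * Fmin⁻¹ ^ 2 * d * fF * β
        + Fmax ^ d * poincareConst P.U * Real.sqrt (volume P.U).toReal * γ)) := by gcongr
    _ = _ := by ring

/-! ### Size of the perturbations, in general and under truncation; continuity in the parameter -/

theorem Regular.ae_norm_f_comp_F_sub_le (hP : P.Regular) {f : E d → ℝ} (hf : ContDiff ℝ 1 f)
    {y y' : Fin N → ℝ} (hy : y ∈ Gam N) (hy' : y' ∈ Gam N) :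
    ∀ᵐ x ∂(volume.restrict P.U), ‖f (P.F x y) - f (P.F x y')‖ ≤
      (c1Norm P.G f).toReal *
        ((∑ l, |y l - y' l| * (Real.sqrt (P.mu l) * linfNorm P.U (P.b l)))
          * linfNorm P.U P.vhat) := by
  filter_upwards [hP.ae_mem, hP.ae_norm_vhat_le, ae_all_iff.2 hP.ae_abs_b_le] with x hx hv hb
  refine (norm_sub_le_of_segment_subset hf (c1Norm_lt_top hf hP.isBounded_G)
    (segment_F_subset_G hx hy' hy)).trans ?_
  refine mul_le_mul_of_nonneg_left ((norm_F_sub_le x y y').trans ?_) ENNReal.toReal_nonneg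
  refine mul_le_mul (Finset.sum_le_sum fun l _ => ?_) hv (norm_nonneg _)
    (Finset.sum_nonneg fun l _ => mul_nonneg (abs_nonneg _)
      (mul_nonneg (Real.sqrt_nonneg _) ENNReal.toReal_nonneg))
  exact mul_le_mul_of_nonneg_left (mul_le_mul_of_nonneg_left (hb l) (Real.sqrt_nonneg _))
    (abs_nonneg _)

theorem SmallPerturbation.ae_norm_jac_sub_le {δ : ℝ} (hδ : P.SmallPerturbation δ)
    (y y' : Fin N → ℝ) :
    ∀ᵐ x ∂(volume.restrict P.U), ‖P.jac x y - P.jac x y'‖ ≤ ‖y - y'‖ * (1 - δ) := by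
  filter_upwards [hδ.bound] with x hx
  refine (norm_jac_sub_le x y y').trans ?_
  calc _ ≤ ∑ l, ‖y - y'‖ * (‖P.B l x‖ * Real.sqrt (P.mu l)) := by
        refine Finset.sum_le_sum fun l _ => ?_
        rw [mul_comm (Real.sqrt _)]
        gcongr
        exact norm_le_pi_norm (y - y') l
    _ ≤ _ := by rw [← Finset.mul_sum]; gcongr

theorem abs_sub_trunc (Ns : ℕ) {y : Fin N → ℝ} (hy : y ∈ Gam N) (l : Fin N) :
    |y l - trunc Ns y l| ≤ if Ns ≤ (l : ℕ) then 1 else 0 := by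
  have h := abs_le_one_of_mem_Gam hy l
  unfold trunc
  split_ifs with h1 h2 h2
  · omega
  · simp
  · simpa using h
  · omega

theorem sum_abs_sub_trunc_le (Ns : ℕ) {y : Fin N → ℝ} (hy : y ∈ Gam N) {c : Fin N → ℝ}
    (hc : ∀ l, 0 ≤ c l) :
    ∑ l, |y l - trunc Ns y l| * c l
      ≤ ∑ i ∈ Finset.univ.filter (fun i : Fin N => Ns ≤ (i : ℕ)), c i := by
  rw [Finset.sum_filter]
  refine Finset.sum_le_sum fun l _ => ?_
  have h := mul_le_mul_of_nonneg_right (abs_sub_trunc Ns hy l) (hc l)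
  simpa using h

theorem SmallPerturbation.ae_norm_jac_sub_trunc_le {δ : ℝ} (hδ : P.SmallPerturbation δ) (Ns : ℕ)
    {y : Fin N → ℝ} (hy : y ∈ Gam N) :
    ∀ᵐ x ∂(volume.restrict P.U), ‖P.jac x y - P.jac x (trunc Ns y)‖ ≤ P.BT Ns := by
  have hbd : ∀ᵐ x ∂(volume.restrict P.U),
      ‖∑ i ∈ Finset.univ.filter (fun i : Fin N => Ns ≤ (i : ℕ)),
        Real.sqrt (P.mu i) * ‖P.B i x‖‖ ≤ 1 - δ := by
    filter_upwards [hδ.bound] with x hx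
    rw [Real.norm_of_nonneg (by positivity)]
    refine le_trans (Finset.sum_le_sum_of_subset_of_nonneg (Finset.filter_subset _ _)
      fun i _ _ => by positivity) (le_trans (le_of_eq ?_) hx)
    exact Finset.sum_congr rfl fun i _ => mul_comm _ _
  -- `BT` is the `toReal` of an essential supremum, so it bounds the tail only once that supremum is
  -- known to be finite.
  have hne := (eLpNormEssSup_lt_top_of_ae_bound hbd).ne
  rw [← eLpNorm_exponent_top] at hne
  filter_upwards [ae_norm_le_linfNorm hne] with x hx
  refine (norm_jac_sub_le x y _).trans
    ((sum_abs_sub_trunc_le Ns hy fun l => by positivity).trans ?_)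
  exact (le_abs_self _).trans hx

theorem BT_nonneg (Ns : ℕ) : 0 ≤ P.BT Ns := ENNReal.toReal_nonneg

theorem CT_nonneg (Ns : ℕ) : 0 ≤ P.CT Ns :=
  Finset.sum_nonneg fun _ _ => mul_nonneg (Real.sqrt_nonneg _) ENNReal.toReal_nonneg

theorem Regular.ae_norm_f_comp_F_sub_trunc_le (hP : P.Regular) {f : E d → ℝ}
    (hf : ContDiff ℝ 1 f) (Ns : ℕ) {y : Fin N → ℝ} (hy : y ∈ Gam N) :
    ∀ᵐ x ∂(volume.restrict P.U), ‖f (P.F x y) - f (P.F x (trunc Ns y))‖ ≤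
      (c1Norm P.G f).toReal * (P.CT Ns * linfNorm P.U P.vhat) := by
  filter_upwards [hP.ae_norm_f_comp_F_sub_le hf hy (trunc_mem_Gam Ns hy)] with x hx
  refine hx.trans ?_
  have h0 : 0 ≤ linfNorm P.U P.vhat := ENNReal.toReal_nonneg
  gcongr
  exact sum_abs_sub_trunc_le Ns hy fun l =>
    mul_nonneg (Real.sqrt_nonneg _) ENNReal.toReal_nonneg

/-- In the stability bound at a fixed $y$ the constants involve only $u(y)$ and $f\circ F(\cdot,y)$,
while $\beta$ and $\gamma$ vanish as $y'\to y$. No uniform bound on $u$ is needed beforehand. -/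
theorem Regular.continuousOn_solution (hd : 0 < d) (hP : P.Regular) (hU : volume P.U ≠ 0)
    {Fmin Fmax : ℝ} (hF : P.JacobianBounds Fmin Fmax)
    {a : E d → (Fin N → ℝ) → ℝ} {amin amax : ℝ} (ha : P.Coefficient a amin amax)
    {δ : ℝ} (hδ : P.SmallPerturbation δ) {f : E d → ℝ} (hf : ContDiff ℝ 1 f) (w : L2Pair P.U)
    {u : (Fin N → ℝ) → H10 P.U} (hu : ∀ y ∈ Gam N, P.IsSolution a f w y (u y)) :
    ContinuousOn u (Gam N) := by
  intro y hy
  rw [ContinuousWithinAt, tendsto_iff_norm_sub_tendsto_zero]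
  have h0 : 0 ≤ linfNorm P.U P.vhat := ENNReal.toReal_nonneg
  have hb0 : ∀ l, 0 ≤ linfNorm P.U (P.b l) := fun l => ENNReal.toReal_nonneg
  have hδ0 : 0 ≤ 1 - δ := by linarith [hδ.lt_one]
  have hbound : ∀ y' ∈ Gam N, _ := fun y' hy' =>
    hP.norm_solution_sub_le hd hU hF ha hδ.lt_one.le hf w hy hy' (hu y hy) (hu y' hy')
      (β := ‖y - y'‖ * (1 - δ))
      (γ := (c1Norm P.G f).toReal *
        ((∑ l, |y l - y' l| * (Real.sqrt (P.mu l) * linfNorm P.U (P.b l)))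
          * linfNorm P.U P.vhat))
      (by positivity)
      (mul_nonneg ENNReal.toReal_nonneg (mul_nonneg (Finset.sum_nonneg fun l _ =>
        mul_nonneg (abs_nonneg _) (mul_nonneg (Real.sqrt_nonneg _) (hb0 l))) h0))
      (hδ.ae_norm_jac_sub_le y y') (hP.ae_norm_f_comp_F_sub_le hf hy hy')
  refine squeeze_zero' (Filter.Eventually.of_forall fun _ => norm_nonneg _)
    (Filter.eventually_of_mem self_mem_nhdsWithin fun y' hy' =>
      (norm_sub_rev _ _).trans_le (hbound y' hy')) ?_
  refine tendsto_nhdsWithin_of_tendsto_nhds ?_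
  refine Continuous.tendsto' (by fun_prop) y 0 ?_
  simp

/-! ### Bochner norms -/

/-- Dominated convergence, with the supremum of $|f|$ on $\mathcal G$ as majorant. This puts the
function in $L^2_\rho$, as Minkowski's inequality requires. -/
theorem Regular.continuousOn_eLpNorm_f_comp_F (hP : P.Regular) {f : E d → ℝ}
    (hf : ContDiff ℝ 1 f) :
    ContinuousOn (fun y => (eLpNorm (fun x => f (P.F x y)) 2 (volume.restrict P.U)).toReal)
      (Gam N) := by
  have : IsFiniteMeasure (volume.restrict P.U) := ⟨by simpa using hP.volume_lt_top⟩
  have h1 : ContinuousOn (fun y => Real.sqrt (∫ x in P.U, ‖f (P.F x y)‖ ^ 2)) (Gam N) := by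
    refine Real.continuous_sqrt.comp_continuousOn ?_
    refine continuousOn_of_dominated (bound := fun _ => (c1Norm P.G f).toReal ^ 2)
      (fun y hy => ((hP.memLp_f_comp_F hf hy).1.norm.pow 2)) (fun y hy => ?_)
      (integrable_const _) (ae_of_all _ fun x => ?_)
    · filter_upwards [hP.ae_mem] with x hx
      rw [norm_pow, norm_norm]
      gcongr
      exact norm_le_c1Norm (c1Norm_lt_top hf hP.isBounded_G) (F_mem_G hx hy)
    · have hFc : Continuous fun y => P.F x y := by unfold F; fun_prop
      exact ((hf.continuous.comp hFc).norm.pow 2).continuousOn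
  refine h1.congr fun y hy => ?_
  have h2 := hP.memLp_f_comp_F hf hy
  have h3 := norm_sq_eq_integral (h2.toLp _)
  rw [Lp.norm_toLp] at h3
  refine (Real.sqrt_eq_iff_mul_self_eq ?_ ENNReal.toReal_nonneg).2 ?_ |>.symm
  · positivity
  · rw [← pow_two, h3]
    refine integral_congr_ae ?_
    filter_upwards [h2.coeFn_toLp] with x hx
    rw [hx]

end Param

section Bochner

variable {N : ℕ} {ρ : (Fin N → ℝ) → ℝ}

theorem ae_mem_Gam : ∀ᵐ y ∂(paramMeasure ρ), y ∈ Gam N :=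
  (withDensity_absolutelyContinuous _ _).ae_le (ae_restrict_mem measurableSet_Gam)

theorem isProbabilityMeasure_paramMeasure
    (hρ1 : ∫⁻ y in Gam N, ENNReal.ofReal (ρ y) = 1) : IsProbabilityMeasure (paramMeasure ρ) :=
  ⟨by rw [paramMeasure, withDensity_apply _ MeasurableSet.univ, Measure.restrict_univ, hρ1]⟩

theorem memLp_of_continuousOn_Gam {X : Type*} [NormedAddCommGroup X]
    (hρ1 : ∫⁻ y in Gam N, ENNReal.ofReal (ρ y) = 1) {g : (Fin N → ℝ) → X}
    (hg : ContinuousOn g (Gam N)) : MemLp g 2 (paramMeasure ρ) := by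
  have := isProbabilityMeasure_paramMeasure hρ1
  obtain ⟨K, hK⟩ := isCompact_Gam.exists_bound_of_continuousOn hg
  refine MemLp.of_bound ?_ K (ae_mem_Gam.mono hK)
  exact (hg.aestronglyMeasurable measurableSet_Gam).mono_ac (withDensity_absolutelyContinuous _ _)

theorem bochnerNorm_add_le {X : Type*} [NormedAddCommGroup X] {g h : (Fin N → ℝ) → X}
    (hg : MemLp g 2 (paramMeasure ρ)) (hh : MemLp h 2 (paramMeasure ρ)) :
    bochnerNorm ρ (fun y => g y + h y) ≤ bochnerNorm ρ g + bochnerNorm ρ h := by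
  rw [bochnerNorm, bochnerNorm, bochnerNorm,
    ← ENNReal.toReal_add hg.eLpNorm_ne_top hh.eLpNorm_ne_top]
  exact ENNReal.toReal_mono (ENNReal.add_ne_top.2 ⟨hg.eLpNorm_ne_top, hh.eLpNorm_ne_top⟩)
    (eLpNorm_add_le hg.1 hh.1 (by simp))

theorem bochnerNorm_const_mul (c : ℝ) (hc : 0 ≤ c) (g : (Fin N → ℝ) → ℝ) :
    bochnerNorm ρ (fun y => c * g y) = c * bochnerNorm ρ g := by
  have : (fun y => c * g y) = c • g := rfl
  rw [bochnerNorm, this, eLpNorm_const_smul, ENNReal.toReal_mul, bochnerNorm]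
  simp [abs_of_nonneg hc]

theorem bochnerNorm_const {X : Type*} [NormedAddCommGroup X]
    (hρ1 : ∫⁻ y in Gam N, ENNReal.ofReal (ρ y) = 1) (c : X) :
    bochnerNorm ρ (fun _ => c) = ‖c‖ := by
  have := isProbabilityMeasure_paramMeasure hρ1
  rw [bochnerNorm, eLpNorm_const' _ (by simp) (by simp)]
  simp

theorem bochnerNorm_le_of_norm_le {X : Type*} [NormedAddCommGroup X] {g : (Fin N → ℝ) → X}
    {h : (Fin N → ℝ) → ℝ} (hh : MemLp h 2 (paramMeasure ρ)) (hgh : ∀ y ∈ Gam N, ‖g y‖ ≤ h y) :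
    bochnerNorm ρ g ≤ bochnerNorm ρ h :=
  ENNReal.toReal_mono hh.eLpNorm_ne_top (eLpNorm_mono_ae (ae_mem_Gam.mono fun y hy =>
    (hgh y hy).trans (le_abs_self _)))

/-- Minkowski's inequality; the constant `c₃` keeps its size because `paramMeasure ρ` has mass one.
-/
theorem bochnerNorm_le_of_affine {X Y : Type*} [NormedAddCommGroup X] [NormedAddCommGroup Y]
    (hρ1 : ∫⁻ y in Gam N, ENNReal.ofReal (ρ y) = 1) {g : (Fin N → ℝ) → X}
    {h : (Fin N → ℝ) → ℝ} {u : (Fin N → ℝ) → Y} {c₁ c₂ c₃ : ℝ}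
    (hc₁ : 0 ≤ c₁) (hc₂ : 0 ≤ c₂) (hc₃ : 0 ≤ c₃)
    (hh : MemLp h 2 (paramMeasure ρ)) (hu : MemLp u 2 (paramMeasure ρ))
    (hg : ∀ y ∈ Gam N, ‖g y‖ ≤ (c₁ * h y + c₂ * ‖u y‖) + c₃) :
    bochnerNorm ρ g ≤ (c₁ * bochnerNorm ρ h + c₂ * bochnerNorm ρ u) + c₃ := by
  have := isProbabilityMeasure_paramMeasure hρ1
  have m₁ : MemLp (fun y => c₁ * h y) 2 (paramMeasure ρ) := hh.const_mul c₁
  have m₂ : MemLp (fun y => c₂ * ‖u y‖) 2 (paramMeasure ρ) := hu.norm.const_mul c₂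
  have m₃ : MemLp (fun _ : Fin N → ℝ => c₃) 2 (paramMeasure ρ) := memLp_const _
  refine (bochnerNorm_le_of_norm_le ((m₁.add m₂).add m₃) hg).trans ?_
  refine (bochnerNorm_add_le (m₁.add m₂) m₃).trans ?_
  have h₁ := bochnerNorm_add_le m₁ m₂
  have e₂ : bochnerNorm ρ (fun y => ‖u y‖) = bochnerNorm ρ u := by
    rw [bochnerNorm, eLpNorm_norm, bochnerNorm]
  rw [bochnerNorm_const_mul c₁ hc₁, bochnerNorm_const_mul c₂ hc₂, e₂] at h₁
  rw [bochnerNorm_const hρ1, Real.norm_of_nonneg hc₃]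
  exact add_le_add_left h₁ c₃

end Bochner

/-! ### Reference domains of measure zero -/

theorem norm_Lp_eq_zero_of_measure_eq_zero {α X : Type*} [MeasurableSpace α] {μ : Measure α}
    [NormedAddCommGroup X] (hμ : μ = 0) (q : Lp X 2 μ) : ‖q‖ = 0 := by
  subst hμ
  simp [Lp.norm_def]

theorem L2Pair_eq_zero {d : ℕ} {U : Set (E d)} (hU : volume U = 0) (p : L2Pair U) : p = 0 := by
  have hr : volume.restrict U = 0 := Measure.restrict_eq_zero.2 hU
  rw [← norm_eq_zero, WithLp.prod_norm_eq_of_L2, norm_Lp_eq_zero_of_measure_eq_zero hr,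
    norm_Lp_eq_zero_of_measure_eq_zero hr]
  simp

end RandomDomain


/-! ### The truncation error in the Bochner norm -/

namespace RandomDomain

namespace Param

variable {d N : ℕ} {P : Param d N}

theorem Regular.bochnerNorm_solution_sub_trunc_le (hd : 0 < d) (Ns : ℕ)
    (hP : P.Regular) (hU : volume P.U ≠ 0)
    {Fmin Fmax : ℝ} (hF : P.JacobianBounds Fmin Fmax)
    {a : E d → (Fin N → ℝ) → ℝ} {amin amax : ℝ} (ha : P.Coefficient a amin amax)
    {δ : ℝ} (hδ : P.SmallPerturbation δ) {f : E d → ℝ} (hf : ContDiff ℝ 1 f) (w : L2Pair P.U)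
    {ρ : (Fin N → ℝ) → ℝ} (hρ1 : ∫⁻ y in Gam N, ENNReal.ofReal (ρ y) = 1)
    {u : (Fin N → ℝ) → H10 P.U} (hu : ∀ y ∈ Gam N, P.IsSolution a f w y (u y)) :
    bochnerNorm ρ (fun y => u y - u (trunc Ns y)) ≤
      (Cconst (poincareConst P.U) amin Fmin Fmax d *
        (poincareConst P.U * Fmax ^ (d - 1) * Fmin⁻¹ ^ 2 * d * P.fNorm ρ f
          + amax * Hconst Fmax Fmin δ d * bochnerNorm ρ (fun _ : Fin N → ℝ => w)
          + amax * Hconst Fmax Fmin δ d * bochnerNorm ρ u)) * P.BT Ns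
      + (Cconst (poincareConst P.U) amin Fmin Fmax d *
          linfNorm P.U P.vhat * Fmax ^ d * poincareConst P.U *
          (c1Norm P.G f).toReal * Real.sqrt (volume P.U).toReal) * P.CT Ns := by
  have hm := hF.pos
  have hM : 0 < Fmax := by linarith [(hF.le_one hd hU).2]
  have hamax := ha.amax_nonneg hU
  have hCP0 : 0 ≤ poincareConst P.U := poincareConst_nonneg
  have hH0 := Hconst_nonneg (d := d) hm.le hM.le hδ.lt_one.le
  have hC0 := Cconst_nonneg (d := d) (CP := poincareConst P.U) (M := Fmax) ha.pos.le hm.le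
  have hv0 : 0 ≤ linfNorm P.U P.vhat := ENNReal.toReal_nonneg
  have hBT := P.BT_nonneg Ns
  have hCT := P.CT_nonneg Ns
  have hγ : 0 ≤ (c1Norm P.G f).toReal * (P.CT Ns * linfNorm P.U P.vhat) := by positivity
  refine (bochnerNorm_le_of_affine hρ1
    (c₁ := Cconst (poincareConst P.U) amin Fmin Fmax d *
      (poincareConst P.U * Fmax ^ (d - 1) * Fmin⁻¹ ^ 2 * d) * P.BT Ns)
    (c₂ := Cconst (poincareConst P.U) amin Fmin Fmax d * (amax * Hconst Fmax Fmin δ d)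
      * P.BT Ns)
    -- The terms independent of $y$: the lifting and the perturbation of $f$.
    (c₃ := Cconst (poincareConst P.U) amin Fmin Fmax d * (amax * Hconst Fmax Fmin δ d * ‖w‖)
      * P.BT Ns + Cconst (poincareConst P.U) amin Fmin Fmax d * Fmax ^ d * poincareConst P.U
      * Real.sqrt (volume P.U).toReal *
        ((c1Norm P.G f).toReal * (P.CT Ns * linfNorm P.U P.vhat)))
    (by positivity) (by positivity) (by positivity)
    (memLp_of_continuousOn_Gam hρ1 (hP.continuousOn_eLpNorm_f_comp_F hf))
    (memLp_of_continuousOn_Gam hρ1 (hP.continuousOn_solution hd hU hF ha hδ hf w hu))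
    fun y hy => ?_).trans (le_of_eq ?_)
  · refine (hP.norm_solution_sub_le hd hU hF ha hδ.lt_one.le hf w hy (trunc_mem_Gam Ns hy)
      (hu y hy) (hu _ (trunc_mem_Gam Ns hy)) hBT hγ
      (hδ.ae_norm_jac_sub_trunc_le Ns hy)
      (hP.ae_norm_f_comp_F_sub_trunc_le hf Ns hy)).trans (le_of_eq ?_)
    ring
  · rw [bochnerNorm_const hρ1, fNorm, bochnerNorm]
    ring

end Param

end RandomDomain

open RandomDomain in
theorem mainTheorem3 {d N : ℕ} (hd : 0 < d) (Ns : ℕ) (hNs : Ns ≤ N)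
    (P : RandomDomain.Param d N) (hP : P.Regular)
    (Fmin Fmax : ℝ) (hF : P.JacobianBounds Fmin Fmax)
    (a : RandomDomain.E d → (Fin N → ℝ) → ℝ) (amin amax : ℝ) (ha : P.Coefficient a amin amax)
    (δ : ℝ) (hδ : P.SmallPerturbation δ)
    (f : RandomDomain.E d → ℝ) (hf : RandomDomain.HasAnalyticExtension f)
    (hfF : ∃ M : ℝ≥0, ∀ y ∈ RandomDomain.Gam N,
      RandomDomain.w1infNorm P.U (fun x => f (P.F x y)) ≤ M)
    (w : RandomDomain.L2Pair P.U) (hw : w ∈ RandomDomain.H1 P.U)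
    (ρ : (Fin N → ℝ) → ℝ) (hρ : Measurable ρ) (hρ0 : ∀ y ∈ RandomDomain.Gam N, 0 ≤ ρ y)
    (hρ1 : ∫⁻ y in RandomDomain.Gam N, ENNReal.ofReal (ρ y) = 1)
    (u : (Fin N → ℝ) → RandomDomain.H10 P.U)
    (hu : ∀ y ∈ RandomDomain.Gam N, P.IsSolution a f w y (u y)) :
    MemLp u 2 (RandomDomain.paramMeasure ρ) ∧
    MemLp (fun y => u (RandomDomain.trunc Ns y)) 2 (RandomDomain.paramMeasure ρ) ∧
    RandomDomain.c1Norm P.G f < ⊤ ∧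
    RandomDomain.bochnerNorm ρ (fun y => u y - u (RandomDomain.trunc Ns y)) ≤
      (RandomDomain.Cconst (RandomDomain.poincareConst P.U) amin Fmin Fmax d *
        (RandomDomain.poincareConst P.U * Fmax ^ (d - 1) * Fmin⁻¹ ^ 2 * d * P.fNorm ρ f
          + amax * RandomDomain.Hconst Fmax Fmin δ d *
              RandomDomain.bochnerNorm ρ (fun _ : Fin N → ℝ => w)
          + amax * RandomDomain.Hconst Fmax Fmin δ d * RandomDomain.bochnerNorm ρ u)) * P.BT Ns
      + (RandomDomain.Cconst (RandomDomain.poincareConst P.U) amin Fmin Fmax d *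
          RandomDomain.linfNorm P.U P.vhat * Fmax ^ d * RandomDomain.poincareConst P.U *
          (RandomDomain.c1Norm P.G f).toReal * Real.sqrt (volume P.U).toReal) * P.CT Ns := by
  have hf1 := hf.contDiff
  have hc1 := c1Norm_lt_top hf1 hP.isBounded_G
  -- On a null set the almost-everywhere bounds are void, so neither $F_{\min}\le1\le F_{\max}$ nor
  -- $a_{\max}\ge0$ is available. But then all functions vanish and both sides are $0$.
  by_cases hU : volume P.U = 0
  · have hu0 : ∀ y, u y = 0 := fun y => Subtype.ext (L2Pair_eq_zero hU _)
    have hu0' : u = fun _ => 0 := funext hu0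
    have hr : volume.restrict P.U = 0 := Measure.restrict_eq_zero.2 hU
    have hBT : P.BT Ns = 0 := by simp [Param.BT, linfNorm, hr]
    have hCT : P.CT Ns = 0 := by simp [Param.CT, linfNorm, hr]
    refine ⟨hu0' ▸ MemLp.zero', by simp only [hu0]; exact MemLp.zero', hc1, ?_⟩
    have hz : (fun y => u y - u (trunc Ns y)) = fun _ => 0 := by
      funext y
      rw [hu0, hu0, sub_zero]
    rw [hBT, hCT, hz, bochnerNorm_const hρ1, norm_zero]
    simp
  have hcont := hP.continuousOn_solution hd hU hF ha hδ hf1 w hu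
  have hcontt : ContinuousOn (fun y => u (trunc Ns y)) (Gam N) :=
    hcont.comp (continuous_trunc Ns).continuousOn fun y hy => trunc_mem_Gam Ns hy
  refine ⟨memLp_of_continuousOn_Gam hρ1 hcont, memLp_of_continuousOn_Gam hρ1 hcontt, hc1, ?_⟩
  exact hP.bochnerNorm_solution_sub_trunc_le hd Ns hU hF ha hδ hf1 w hρ1 hu
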